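/- Let $n,d,T\ge 1$ be integers and consider $F=f+\psi$ on $\mathbb R^d$ with $f=\frac1n\sum_{i=1}^n f_i$, where each $f_i:\mathbb R^d\to\mathbb R$ is convex, $\psi:\mathbb R^d\to(-\infty,+\infty]$ is proper, closed and convex, and each $f_i$ is $G_i$-Lipschitz on $\operatorname{dom}\psi$ for some $G_i>0$. Put $G_{f,1}=\frac1n\sum_i G_i$ and $G_{f,2}=\sqrt{\frac1n\sum_i G_i^2}$. For each $i$ and $x$ let $\nabla f_i(x)\in\partial f_i(x)$ be a deterministically selected subgradient; for $x\in\operatorname{dom}\psi$ the linear function $y\mapsto\langle\nabla f_i(x),y\rangle$ is assumed to be $G_i$-Lipschitz on $\operatorname{dom}\psi$ (this holds if $\|\nabla f_i(x)\|\le G_i$, and it holds automatically if $x$ is in the relative interior of $\operatorname{dom}\psi$). Write $q(t)=\lceil t/n\rceil$ and $r(t)=t-(q(t)-1)n\in\{1,\dots,n\}$. Let $\pi_1,\dots,\pi_{q(T)}$ be mutually independent uniformly random permutations of $\{1,\dots,n\}$ (Random Reshuffle), let $x_1\in\operatorname{dom}\psi$, and for $t=1,\dots,T$ let $$x_{t+1}=\operatorname*{argmin}_{x\in\mathbb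 R^d}\ \psi(x)+\langle\nabla f_{I(t)}(x_t),x\rangle+\frac{\|x-x_t\|^2}{2\eta_t},\qquad I(t)=\pi_{q(t)}^{r(t)} .$$ Then $F(x_{T+1})$ is finite and integrable, and there is an absolute constant $C$ such that the following holds for all such data and all $T\ge1$. (1) For every $\eta>0$ and every $z\in\mathbb R^d$, $$\mathbb E[F(x_{T+1})-F(z)]\le \frac{C}{\sqrt T}\Big(\frac{\|z-x_1\|^2}{\eta}+\eta\sqrt n\,G_{f,1}G_{f,2}\,L\Big),$$ where $L=1+\frac{\log n}{q(T)}$ for the stepsize $\eta_t=\eta\frac{q(T)-q(t)+1}{q(T)\sqrt T}$, and $L=1+\log T$ for each of the stepsizes $\eta_t=\frac{\eta}{\sqrt T}$ and $\eta_t=\frac{\eta}{\sqrt t}$. (2) Let $z\ne x_1$ and $D=\|z-x_1\|$. With $\eta=\frac{D}{n^{1/4}\sqrt{G_{f,1}G_{f,2}L}}$ in the first two stepsizes, respectively $\eta=\frac{D}{n^{1/4}\sqrt{G_{f,1}G_{f,2}}}$ in the third, $$\mathbb E[F(x_{T+1})-F(z)]\le C\,\frac{n^{1/4}\sqrt{G_{f,1}G_{f,2}}\,D}{\sqrt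 T}\,\Lambda,$$ where $\Lambda=\sqrt{1+\frac{\log n}{q(T)}}$, $\sqrt{1+\log T}$, $1+\log T$ for the three stepsizes respectively. (3) For every $c>0$ there is a constant $C_c$ depending only on $c$ such that, if $T\ge c\,n\log n$, the first stepsize with $\eta$ as in (2) satisfies $$\mathbb E[F(x_{T+1})-F(z)]\le C_c\,\frac{n^{1/4}\sqrt{G_{f,1}G_{f,2}}\,D}{\sqrt T}.$$ In particular, if $F$ attains its minimum at some $x_\star\neq x_1$, then (2) and (3) with $z=x_\star$ bound $\mathbb E[F(x_{T+1})-F_\star]$, where $F_\star=\inf F$ and $D=D_\star=\|x_\star-x_1\|$. -/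

import Mathlib

open MeasureTheory ProbabilityTheory Set

noncomputable section

namespace ShuffledProx

/-- Euclidean space `ℝ^d` with its 2-norm. -/
abbrev Vec (d : ℕ) : Type := EuclideanSpace ℝ (Fin d)

/-- The epigraph of an extended-real-valued function. -/
def epigraph {d : ℕ} (h : Vec d → EReal) : Set (Vec d × ℝ) :=
  {p | h p.1 ≤ (p.2 : EReal)}

/-- `h : ℝ^d → (-∞, +∞]` is proper, closed and convex: it never takes the value `-∞`, it is not
identically `+∞`, and its epigraph is closed and convex. -/
structure IsProperClosedConvex {d : ℕ} (h : Vec d → EReal) : Prop where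
  ne_bot : ∀ x, h x ≠ ⊥
  exists_ne_top : ∃ x, h x ≠ ⊤
  isClosed_epigraph : IsClosed (epigraph h)
  convex_epigraph : Convex ℝ (epigraph h)

/-- The effective domain `{x | h x < +∞}`. -/
def dom {d : ℕ} (h : Vec d → EReal) : Set (Vec d) := {x | h x < ⊤}

/-- The subdifferential at `x` of a finite function `h : ℝ^d → ℝ`. -/
def subdifferential {d : ℕ} (h : Vec d → ℝ) (x : Vec d) : Set (Vec d) :=
  {g | ∀ y, h x + inner ℝ g (y - x) ≤ h y}

/-- The problem `min F = (1/n) ∑ f_i + ψ` with `f_i` convex on `ℝ^d` and `G_i`-Lipschitz on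
`dom ψ`, and `ψ` proper, closed and convex, together with a deterministic subgradient oracle
`grad i x ∈ ∂ f_i(x)`. -/
structure Problem (d n : ℕ) where
  /-- the component functions -/
  f : Fin n → Vec d → ℝ
  /-- the regularizer -/
  ψ : Vec d → EReal
  /-- the Lipschitz parameters -/
  G : Fin n → ℝ
  /-- the subgradient oracle -/
  grad : Fin n → Vec d → Vec d
  f_convex : ∀ i, ConvexOn ℝ univ (f i)
  ψ_properClosedConvex : IsProperClosedConvex ψ
  G_pos : ∀ i, 0 < G i
  f_lipschitz : ∀ i, ∀ x ∈ dom ψ, ∀ y ∈ dom ψ, |f i x - f i y| ≤ G i * ‖x - y‖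
  grad_mem : ∀ i x, grad i x ∈ subdifferential (f i) x
  /-- At points of `dom ψ` the linear functional given by the selected subgradient is also
  `G_i`-Lipschitz on `dom ψ`. This follows from `‖grad i x‖ ≤ G i`, and it follows from
  `f_lipschitz` at every point of the relative interior of `dom ψ`; it only constrains the
  selection at relative boundary points, where `∂ f_i` may contain arbitrarily long vectors. -/
  grad_lipschitz : ∀ i, ∀ x ∈ dom ψ, ∀ y ∈ dom ψ, ∀ z ∈ dom ψ,
    inner ℝ (grad i x) (y - z) ≤ G i * ‖y - z‖

namespace Problem

variable {d n : ℕ}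

/-- The objective `F = (1/n) ∑ f_i + ψ`. -/
def F (p : Problem d n) (x : Vec d) : EReal :=
  (((1 / (n : ℝ)) * ∑ i, p.f i x : ℝ) : EReal) + p.ψ x

/-- The arithmetic mean of the Lipschitz parameters. -/
def G1 (p : Problem d n) : ℝ := (1 / (n : ℝ)) * ∑ i, p.G i

/-- The root mean square of the Lipschitz parameters. -/
def G2 (p : Problem d n) : ℝ := Real.sqrt ((1 / (n : ℝ)) * ∑ i, p.G i ^ 2)

/-- The function minimized in one proximal step from `x` with index `i` and stepsize `η`. -/
def stepObjective (p : Problem d n) (i : Fin n) (η : ℝ) (x y : Vec d) : EReal :=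
  p.ψ y + ((inner ℝ (p.grad i x) y + ‖y - x‖ ^ 2 / (2 * η) : ℝ) : EReal)

/-- `x 1, …, x (T + 1)` are the iterates of the proximal gradient method started at `x₁`, with
index sequence `I 1, …, I T` and stepsizes `η 1, …, η T`. -/
def IsRun (p : Problem d n) (x₁ : Vec d) (T : ℕ) (I : ℕ → Fin n) (η : ℕ → ℝ)
    (x : ℕ → Vec d) : Prop :=
  x 1 = x₁ ∧
    ∀ t, 1 ≤ t → t ≤ T → IsMinOn (p.stepObjective (I t) (η t) (x t)) univ (x (t + 1))

end Problem

/-- The epoch `⌈t / n⌉` that step `t ≥ 1` belongs to. -/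
def epoch (n t : ℕ) : ℕ := t ⌈/⌉ n

/-- `π 1, …, π K` are mutually independent, uniformly distributed random permutations. -/
structure IsReshuffling {Ω : Type*} [MeasurableSpace Ω] (P : Measure Ω) (n K : ℕ)
    (π : ℕ → Ω → Equiv.Perm (Fin n)) : Prop where
  measurable : ∀ k ∈ Finset.Icc 1 K, Measurable[_, ⊤] (π k)
  uniform : ∀ k ∈ Finset.Icc 1 K, ∀ σ : Equiv.Perm (Fin n),
    P {ω | π k ω = σ} = ((n.factorial : ENNReal))⁻¹
  independent : iIndepFun (m := fun _ => ⊤) (fun k : Finset.Icc 1 K => π k) P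

/-- The Random Reshuffle index at step `t ≥ 1`: the entry of the permutation of epoch `⌈t / n⌉` at
the position of `t` inside its epoch (positions are counted from `0`). -/
def rrIndex {Ω : Type*} {n : ℕ} [NeZero n] (π : ℕ → Ω → Equiv.Perm (Fin n)) (ω : Ω) (t : ℕ) :
    Fin n :=
  π (epoch n t) ω (Fin.ofNat n (t - 1))

/-- The random iterates of the proximal gradient method under Random Reshuffle. -/
def IsRRRun {Ω : Type*} {d n : ℕ} [NeZero n] (p : Problem d n) (x₁ : Vec d) (T : ℕ)
    (π : ℕ → Ω → Equiv.Perm (Fin n)) (η : ℕ → ℝ) (x : ℕ → Ω → Vec d) : Prop :=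
  ∀ ω, p.IsRun x₁ T (rrIndex π ω) η (fun t => x t ω)

/-- The stepsize `η (⌈T/n⌉ - ⌈t/n⌉ + 1) / (⌈T/n⌉ √T)`. -/
def stepEpochDecay (n T : ℕ) (η : ℝ) (t : ℕ) : ℝ :=
  η * (((epoch n T : ℝ) - (epoch n t : ℝ) + 1) / ((epoch n T : ℝ) * Real.sqrt T))

/-- The constant stepsize `η / √T`. -/
def stepConst (T : ℕ) (η : ℝ) (_t : ℕ) : ℝ := η / Real.sqrt T

/-- The stepsize `η / √t`. -/
def stepSqrt (η : ℝ) (t : ℕ) : ℝ := η / Real.sqrt t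

/-- `E[F(X)] ≤ v + B`, where `F(X)` is always finite and has a finite expectation. -/
def ExpectedGapLE {Ω : Type*} [MeasurableSpace Ω] (P : Measure Ω) {d n : ℕ} (p : Problem d n)
    (X : Ω → Vec d) (v : EReal) (B : ℝ) : Prop :=
  (∀ ω, p.F (X ω) < ⊤) ∧
    Integrable (fun ω => (p.F (X ω)).toReal) P ∧
    ((∫ ω, (p.F (X ω)).toReal ∂P : ℝ) : EReal) ≤ v + (B : EReal)

end ShuffledProx

end

/-!
The last iterate of the proximal subgradient method under Random Reshuffle.

Write `V = √n G_{f,1} G_{f,2}` (`Problem.noise`). The proof treats Random Reshuffle as a stochastic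
method with a bias. Only finitely many permutations matter, and the proximal step is unique, so every
expectation is a uniform average over the sequences of `⌈T / n⌉` permutations
(`exists_run_permSeq`, `IsReshuffling.integral_comp`).

*Bias.* If two steps `s`, `t` of one epoch are exchanged, the law of the permutations does not change,
so `E f_{I(s)}(x_u)` equals `E f_{I(t)}(x_u')` with `x'` the run of the exchanged sequence. The two
runs stay close: at the steps `s` and `t` they separate by `O(η G)`, and at the common steps in
between the squared distance grows by `O(η² G²)` only, because subdifferentials are monotone
(`Problem.IsRun.norm_sub_le_of_swap`). Over an epoch this amounts to a distance `O(η √n G_{f,2})`.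
Averaging over `s` shows that `E f_{I(t)}(x_u)` differs from `E f(x_u)` by at most `11 V η_t`, for
every `u ≤ t + 1` (`abs_expect_f_sub_loss_le`).

*Last iterate.* With this bias, one proximal step gives, for `a_t = E F(x_t)` and for the reference
point `y` being `z` or any earlier iterate `x_u`,
`η_t (a_{t+1} - E F(y)) + E ‖x_{t+1} - y‖² / 2 ≤ E ‖x_t - y‖² / 2 + 24 V η_t²`.
Summing these inequalities with suitable weights yields (`last_iterate_bound`)
`a_{T+1} - F(z) ≤ ‖z - x₁‖² / (2 S_1) + 24 V ∑_t η_t² / S_t`, where `S_t = η_t + ⋯ + η_T`.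

*Stepsizes.* For the three stepsizes `S_1 ≥ η √T / 2` and `∑_t η_t² / S_t = O(η L / √T)`
(`StepsizeRate`); the scale `η` then only has to be tuned.
-/

noncomputable section

namespace ShuffledProx

/-! ### The proximal step -/

section ProximalStep

variable {E : Type*} [NormedAddCommGroup E] [InnerProductSpace ℝ E]

/-- The optimality condition of the proximal step `u` from `x` in direction `g`, as a variational
inequality; it needs only convexity of `φ` on `C`. -/
theorem prox_variational {C : Set E} {φ : E → ℝ} (hφ : ConvexOn ℝ C φ) {g x u : E} {η : ℝ}
    (hη : 0 < η) (hu : u ∈ C)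
    (hmin : ∀ y ∈ C, φ u + (inner ℝ g u + ‖u - x‖ ^ 2 / (2 * η)) ≤
      φ y + (inner ℝ g y + ‖y - x‖ ^ 2 / (2 * η))) {y : E} (hy : y ∈ C) :
    η * (φ u - φ y) + η * inner ℝ g (u - y) + inner ℝ (u - x) (u - y) ≤ 0 := by
  set A := η * (φ u - φ y) + η * inner ℝ g (u - y) + inner ℝ (u - x) (u - y) with hA
  -- Comparing `u` with the point `u + θ (y - u)` gives the inequality up to a term of order `θ`.
  have key : ∀ θ : ℝ, 0 < θ → θ ≤ 1 → A ≤ θ * (‖u - y‖ ^ 2 / 2) := by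
    intro θ h0 h1
    have hw : (1 - θ) • u + θ • y ∈ C := hφ.1 hu hy (by linarith) h0.le (by ring)
    have hc := hφ.2 hu hy (by linarith : 0 ≤ 1 - θ) h0.le (by ring)
    have hm := hmin _ hw
    have e1 : ((1 - θ) • u + θ • y) - x = (u - x) - θ • (u - y) := by module
    have e2 : inner ℝ g ((1 - θ) • u + θ • y) = inner ℝ g u - θ * inner ℝ g (u - y) := by
      simp only [inner_add_right, inner_smul_right, inner_sub_right]; ring
    rw [e1, e2, norm_sub_sq_real (u - x) (θ • (u - y)), norm_smul, inner_smul_right,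
      Real.norm_of_nonneg h0.le] at hm
    simp only [smul_eq_mul] at hc
    have h2 : φ u + (inner ℝ g u + ‖u - x‖ ^ 2 / (2 * η)) ≤ ((1 - θ) * φ u + θ * φ y) +
        (inner ℝ g u - θ * inner ℝ g (u - y) + (‖u - x‖ ^ 2 - 2 * (θ * inner ℝ (u - x) (u - y)) +
          (θ * ‖u - y‖) ^ 2) / (2 * η)) := by linarith
    have h3 := mul_le_mul_of_nonneg_left h2 hη.le
    have e3 : ∀ a : ℝ, η * (a / (2 * η)) = a / 2 := fun a => by field_simp
    simp only [mul_add, e3] at h3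
    have h4 : θ * A ≤ θ * (θ * (‖u - y‖ ^ 2 / 2)) := by rw [hA]; nlinarith
    exact le_of_mul_le_mul_left h4 h0
  by_contra hpos
  push Not at hpos
  have hq : 0 ≤ ‖u - y‖ ^ 2 / 2 := by positivity
  set q := ‖u - y‖ ^ 2 / 2
  have hk := key (min 1 (A / (2 * (q + 1)))) (lt_min one_pos (by positivity)) (min_le_left _ _)
  have h5 : min 1 (A / (2 * (q + 1))) * q ≤ A / (2 * (q + 1)) * (q + 1) := by
    gcongr
    · exact min_le_right _ _
    · linarith
  have h6 : A / (2 * (q + 1)) * (q + 1) = A / 2 := by field_simp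
  linarith

end ProximalStep

namespace Problem

variable {d n : ℕ}

/-- The regularizer as a real function; it is meaningful on `dom ψ` only. -/
def reg (p : Problem d n) (x : Vec d) : ℝ := (p.ψ x).toReal

theorem coe_reg (p : Problem d n) {x : Vec d} (hx : x ∈ dom p.ψ) :
    ((p.reg x : ℝ) : EReal) = p.ψ x :=
  EReal.coe_toReal (ne_of_lt hx) (p.ψ_properClosedConvex.ne_bot x)

theorem convexOn_reg (p : Problem d n) : ConvexOn ℝ (dom p.ψ) p.reg := by
  have key : ∀ x ∈ dom p.ψ, ∀ y ∈ dom p.ψ, ∀ a b : ℝ, 0 ≤ a → 0 ≤ b → a + b = 1 →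
      p.ψ (a • x + b • y) ≤ ((a • p.reg x + b • p.reg y : ℝ) : EReal) := by
    intro x hx y hy a b ha hb hab
    have h1 : (x, p.reg x) ∈ epigraph p.ψ := (p.coe_reg hx).ge
    have h2 : (y, p.reg y) ∈ epigraph p.ψ := (p.coe_reg hy).ge
    exact p.ψ_properClosedConvex.convex_epigraph h1 h2 ha hb hab
  refine ⟨fun x hx y hy a b ha hb hab => (key x hx y hy a b ha hb hab).trans_lt
    (EReal.coe_lt_top _), fun x hx y hy a b ha hb hab => ?_⟩
  have h := key x hx y hy a b ha hb hab
  rw [← p.coe_reg (h.trans_lt (EReal.coe_lt_top _))] at h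
  exact_mod_cast h

theorem mem_dom_of_isMinOn (p : Problem d n) {i : Fin n} {η : ℝ} {x u : Vec d}
    (h : IsMinOn (p.stepObjective i η x) univ u) : u ∈ dom p.ψ := by
  obtain ⟨y, hy⟩ := p.ψ_properClosedConvex.exists_ne_top
  have h1 : p.stepObjective i η x u ≤ p.stepObjective i η x y := h (mem_univ y)
  by_contra hu
  have h2 : p.ψ u = ⊤ := by simpa [dom] using hu
  simp only [stepObjective, h2, EReal.top_add_coe, top_le_iff] at h1
  exact (EReal.add_lt_top hy (EReal.coe_ne_top _)).ne h1

theorem step_variational (p : Problem d n) {i : Fin n} {η : ℝ} (hη : 0 < η) {x u y : Vec d}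
    (h : IsMinOn (p.stepObjective i η x) univ u) (hy : y ∈ dom p.ψ) :
    η * (p.reg u - p.reg y) + η * inner ℝ (p.grad i x) (u - y) + inner ℝ (u - x) (u - y) ≤ 0 := by
  have hu := p.mem_dom_of_isMinOn h
  refine prox_variational p.convexOn_reg hη hu (fun y hy => ?_) hy
  have h1 : p.stepObjective i η x u ≤ p.stepObjective i η x y := h (mem_univ y)
  simp only [stepObjective, ← p.coe_reg hu, ← p.coe_reg hy] at h1
  exact_mod_cast h1

/-- The proximal step is unique. -/
theorem step_unique (p : Problem d n) {i : Fin n} {η : ℝ} (hη : 0 < η) {x u v : Vec d}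
    (hu : IsMinOn (p.stepObjective i η x) univ u) (hv : IsMinOn (p.stepObjective i η x) univ v) :
    u = v := by
  have h1 := p.step_variational hη hu (p.mem_dom_of_isMinOn hv)
  have h2 := p.step_variational hη hv (p.mem_dom_of_isMinOn hu)
  have h3 : ‖u - v‖ ^ 2 ≤ 0 := by
    rw [← real_inner_self_eq_norm_sq]
    simp only [inner_sub_left, inner_sub_right] at h1 h2 ⊢
    linarith
  have h4 : ‖u - v‖ = 0 := by nlinarith [norm_nonneg (u - v)]
  exact sub_eq_zero.mp (norm_eq_zero.mp h4)

/-- One step decreases the squared distance to any `y ∈ dom ψ` by the gap of `f_i + ψ` between the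
new iterate and `y`, up to an error of second order in the stepsize. -/
theorem step_descent (p : Problem d n) {i : Fin n} {η : ℝ} (hη : 0 < η) {x u y : Vec d}
    (hx : x ∈ dom p.ψ) (h : IsMinOn (p.stepObjective i η x) univ u) (hy : y ∈ dom p.ψ) :
    η * ((p.f i u + p.reg u) - (p.f i y + p.reg y)) + ‖u - y‖ ^ 2 / 2 ≤
      ‖x - y‖ ^ 2 / 2 + 2 * (η * p.G i) ^ 2 := by
  have hu := p.mem_dom_of_isMinOn h
  have h1 := p.step_variational hη h hy
  have h2 : p.f i x + inner ℝ (p.grad i x) (y - x) ≤ p.f i y := p.grad_mem i x y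
  have h3 := (abs_le.mp (p.f_lipschitz i u hu x hx)).2
  have h4 := p.grad_lipschitz i x hx x hx u hu
  have e1 : inner ℝ (p.grad i x) (u - y) =
      -inner ℝ (p.grad i x) (y - x) - inner ℝ (p.grad i x) (x - u) := by
    simp only [inner_sub_right]; ring
  have e2 : ‖x - y‖ ^ 2 = ‖u - y‖ ^ 2 - 2 * inner ℝ (u - x) (u - y) + ‖x - u‖ ^ 2 := by
    have : x - y = (u - y) - (u - x) := by abel
    rw [this, norm_sub_sq_real, norm_sub_rev x u, real_inner_comm]
  rw [norm_sub_rev u x] at h3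
  have h5 : p.f i u - p.f i y ≤ inner ℝ (p.grad i x) (u - y) + 2 * (p.G i * ‖x - u‖) := by
    linarith
  have h6 := mul_le_mul_of_nonneg_left h5 hη.le
  nlinarith [sq_nonneg (‖x - u‖ - 2 * (η * p.G i))]

/-- Steps with two arbitrary indices expand distances by at most an additive term. -/
theorem step_stability (p : Problem d n) {i j : Fin n} {η : ℝ} (hη : 0 < η) {x y u v : Vec d}
    (hx : x ∈ dom p.ψ) (hy : y ∈ dom p.ψ) (hu : IsMinOn (p.stepObjective i η x) univ u)
    (hv : IsMinOn (p.stepObjective j η y) univ v) :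
    ‖u - v‖ ≤ ‖x - y‖ + η * (p.G i + p.G j) := by
  have hud := p.mem_dom_of_isMinOn hu
  have hvd := p.mem_dom_of_isMinOn hv
  have h1 := p.step_variational hη hu hvd
  have h2 := p.step_variational hη hv hud
  have h3 := p.grad_lipschitz i x hx v hvd u hud
  have h4 := p.grad_lipschitz j y hy u hud v hvd
  have h5 := real_inner_le_norm (x - y) (u - v)
  have e : inner ℝ (u - x) (u - v) + inner ℝ (v - y) (v - u) =
      ‖u - v‖ ^ 2 - inner ℝ (x - y) (u - v) := by
    rw [← real_inner_self_eq_norm_sq]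
    simp only [inner_sub_left, inner_sub_right]; ring
  have e3 : inner ℝ (p.grad i x) (u - v) = -inner ℝ (p.grad i x) (v - u) := by
    simp only [inner_sub_right]; ring
  have e4 : inner ℝ (p.grad j y) (v - u) = -inner ℝ (p.grad j y) (u - v) := by
    simp only [inner_sub_right]; ring
  rw [e3] at h1
  rw [e4] at h2
  rw [norm_sub_rev v u] at h3
  have h3' := mul_le_mul_of_nonneg_left h3 hη.le
  have h4' := mul_le_mul_of_nonneg_left h4 hη.le
  by_contra hc
  push Not at hc
  have hpos : 0 < ‖u - v‖ := lt_of_le_of_lt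
    (add_nonneg (norm_nonneg _) (mul_nonneg hη.le (add_nonneg (p.G_pos i).le (p.G_pos j).le))) hc
  nlinarith [mul_lt_mul_of_pos_right hc hpos]

/-- Steps with the same index expand squared distances by at most a term of second order in the
stepsize, because the subdifferential of `f_i` is monotone. -/
theorem step_stability_sq (p : Problem d n) {i : Fin n} {η : ℝ} (hη : 0 < η) {x y u v : Vec d}
    (hx : x ∈ dom p.ψ) (hy : y ∈ dom p.ψ) (hu : IsMinOn (p.stepObjective i η x) univ u)
    (hv : IsMinOn (p.stepObjective i η y) univ v) :
    ‖u - v‖ ^ 2 ≤ ‖x - y‖ ^ 2 + 4 * (η * p.G i) ^ 2 := by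
  have hud := p.mem_dom_of_isMinOn hu
  have hvd := p.mem_dom_of_isMinOn hv
  have h1 := p.step_variational hη hu hvd
  have h2 := p.step_variational hη hv hud
  -- `(u - v) - (x - y)` is twice a difference of two midpoints of points of `dom ψ`, so the
  -- Lipschitz property of the subgradients applies to it.
  have hm1 : (1 / 2 : ℝ) • u + (1 / 2 : ℝ) • y ∈ dom p.ψ :=
    p.convexOn_reg.1 hud hy (by norm_num) (by norm_num) (by norm_num)
  have hm2 : (1 / 2 : ℝ) • v + (1 / 2 : ℝ) • x ∈ dom p.ψ :=
    p.convexOn_reg.1 hvd hx (by norm_num) (by norm_num) (by norm_num)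
  have h3 := p.grad_lipschitz i x hx _ hm2 _ hm1
  have h4 := p.grad_lipschitz i y hy _ hm1 _ hm2
  have e1 : ((1 / 2 : ℝ) • v + (1 / 2 : ℝ) • x) - ((1 / 2 : ℝ) • u + (1 / 2 : ℝ) • y) =
      -((1 / 2 : ℝ) • ((u - v) - (x - y))) := by module
  have e2 : ((1 / 2 : ℝ) • u + (1 / 2 : ℝ) • y) - ((1 / 2 : ℝ) • v + (1 / 2 : ℝ) • x) =
      ((1 / 2 : ℝ) • ((u - v) - (x - y))) := by module
  rw [e1, norm_neg, norm_smul, inner_neg_right, inner_smul_right] at h3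
  rw [e2, norm_smul, inner_smul_right] at h4
  norm_num at h3 h4
  have h5 : p.f i x + inner ℝ (p.grad i x) (y - x) ≤ p.f i y := p.grad_mem i x y
  have h6 : p.f i y + inner ℝ (p.grad i y) (x - y) ≤ p.f i x := p.grad_mem i y x
  have e3 : ‖(u - v) - (x - y)‖ ^ 2 = ‖u - v‖ ^ 2 - 2 * inner ℝ (x - y) (u - v) + ‖x - y‖ ^ 2 := by
    rw [norm_sub_sq_real, real_inner_comm]
  have e : inner ℝ (u - x) (u - v) + inner ℝ (v - y) (v - u) =
      ‖u - v‖ ^ 2 - inner ℝ (x - y) (u - v) := by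
    rw [← real_inner_self_eq_norm_sq]
    simp only [inner_sub_left, inner_sub_right]; ring
  set w := ‖(u - v) - (x - y)‖
  have h7 : -inner ℝ (p.grad i x) (u - v) - inner ℝ (p.grad i y) (v - u) ≤ 2 * (p.G i * w) := by
    simp only [inner_sub_right] at h3 h4 h5 h6 ⊢
    linarith
  have h8 := mul_le_mul_of_nonneg_left h7 hη.le
  nlinarith [sq_nonneg (w - 2 * (η * p.G i))]

end Problem

namespace Problem

variable {d n : ℕ}

/-! ### Stability of runs -/

section Runs

variable {p : Problem d n} {x₁ : Vec d} {T : ℕ} {I I' : ℕ → Fin n} {η : ℕ → ℝ} {x x' : ℕ → Vec d}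

theorem IsRun.mem_dom (h : p.IsRun x₁ T I η x) (hx₁ : x₁ ∈ dom p.ψ) {t : ℕ} (ht : 1 ≤ t)
    (htT : t ≤ T + 1) : x t ∈ dom p.ψ := by
  obtain rfl | ht' := ht.eq_or_lt
  · rw [h.1]; exact hx₁
  · obtain ⟨k, rfl⟩ : ∃ k, t = k + 1 := ⟨t - 1, by omega⟩
    exact p.mem_dom_of_isMinOn (h.2 k (by omega) (by omega))

/-- An iterate depends only on the indices used before it. -/
theorem IsRun.eq_of_forall_lt (h : p.IsRun x₁ T I η x) (h' : p.IsRun x₁ T I' η x')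
    (hη : ∀ t, 1 ≤ t → t ≤ T → 0 < η t) {u : ℕ} (hu : 1 ≤ u) (huT : u ≤ T + 1)
    (hI : ∀ k, 1 ≤ k → k < u → I k = I' k) : x u = x' u := by
  induction u, hu using Nat.le_induction with
  | base => rw [h.1, h'.1]
  | succ k hk ih =>
    have h1 := h.2 k hk (by omega)
    have h2 := h'.2 k hk (by omega)
    rw [hI k hk (by omega), ih (by omega) fun j hj hjk => hI j hj (by omega)] at h1
    exact p.step_unique (hη k hk (by omega)) h1 h2

/-- If the indices of two runs differ only at step `s`, their distance after that step grows only
through the second-order terms of the common steps. -/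
theorem IsRun.norm_sub_sq_le (h : p.IsRun x₁ T I η x) (h' : p.IsRun x₁ T I' η x')
    (hx₁ : x₁ ∈ dom p.ψ) (hη : ∀ t, 1 ≤ t → t ≤ T → 0 < η t) {s u : ℕ} (hs : 1 ≤ s) (hsu : s < u)
    (huT : u ≤ T + 1) (hI : ∀ k, 1 ≤ k → k < u → k ≠ s → I k = I' k) :
    ‖x u - x' u‖ ^ 2 ≤ (η s * (p.G (I s) + p.G (I' s))) ^ 2 +
      4 * ∑ k ∈ Finset.Ioo s u, (η k * p.G (I k)) ^ 2 := by
  induction u, Nat.succ_le_iff.mpr hsu using Nat.le_induction with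
  | base =>
    have h0 : x s = x' s := h.eq_of_forall_lt h' hη hs (by omega)
      fun k hk hks => hI k hk (by omega) (by omega)
    have h1 := p.step_stability (hη s hs (by omega)) (h.mem_dom hx₁ hs (by omega))
      (h'.mem_dom hx₁ hs (by omega)) (h.2 s hs (by omega)) (h'.2 s hs (by omega))
    rw [h0, sub_self, norm_zero, zero_add] at h1
    have e : Finset.Ioo s (s + 1) = ∅ := by ext; simp
    rw [Nat.succ_eq_add_one, e, Finset.sum_empty, mul_zero, add_zero]
    gcongr
  | succ k hk ih =>
    have h0 := ih (by omega) (by omega) fun j hj hjk hjs => hI j hj (by omega) hjs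
    have h2 := h'.2 k (by omega) (by omega)
    rw [← hI k (by omega) (by omega) (by omega)] at h2
    have h1 := p.step_stability_sq (hη k (by omega) (by omega))
      (h.mem_dom hx₁ (by omega) (by omega)) (h'.mem_dom hx₁ (by omega) (by omega))
      (h.2 k (by omega) (by omega)) h2
    have e : Finset.Ioo s (k + 1) = insert k (Finset.Ioo s k) := by ext; simp; omega
    rw [e, Finset.sum_insert (by simp)]
    linarith

/-- If the indices of two runs are exchanged between the steps `s < t`, then up to step `t + 1`
their distance is first order only in the stepsizes at `s` and `t`. The free parameter `c` linearizes
the square root of the second-order terms. -/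
theorem IsRun.norm_sub_le_of_swap (h : p.IsRun x₁ T I η x) (h' : p.IsRun x₁ T I' η x')
    (hx₁ : x₁ ∈ dom p.ψ) (hη : ∀ t, 1 ≤ t → t ≤ T → 0 < η t) {s t u : ℕ} (hs : 1 ≤ s) (hst : s < t)
    (htT : t ≤ T) (hu : 1 ≤ u) (hut : u ≤ t + 1)
    (hI : ∀ k, 1 ≤ k → k < t → k ≠ s → I k = I' k) (hIs : I' s = I t) (hIt : I' t = I s)
    {c : ℝ} (hc : 0 < c) :
    ‖x u - x' u‖ ≤ (η s + η t) * (p.G (I s) + p.G (I t)) +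
      (c + (∑ k ∈ Finset.Ioo s t, (η k * p.G (I k)) ^ 2) / c) := by
  have hGs := p.G_pos (I s)
  have hGt := p.G_pos (I t)
  have hηs := hη s hs (by omega)
  have hηt := hη t (by omega) htT
  have hsum : 0 ≤ ∑ k ∈ Finset.Ioo s t, (η k * p.G (I k)) ^ 2 :=
    Finset.sum_nonneg fun _ _ => sq_nonneg _
  have main : ∀ v, 1 ≤ v → v ≤ t → ‖x v - x' v‖ ≤ η s * (p.G (I s) + p.G (I t)) +
      (c + (∑ k ∈ Finset.Ioo s t, (η k * p.G (I k)) ^ 2) / c) := by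
    intro v hv hvt
    obtain hvs | hvs := le_or_gt v s
    · rw [h.eq_of_forall_lt h' hη hv (by omega) fun k hk hkv => hI k hk (by omega) (by omega),
        sub_self, norm_zero]
      positivity
    · have h1 := h.norm_sub_sq_le h' hx₁ hη hs hvs (by omega)
        fun k hk hkv hks => hI k hk (by omega) hks
      rw [hIs] at h1
      have h2 : ∑ k ∈ Finset.Ioo s v, (η k * p.G (I k)) ^ 2 ≤
          ∑ k ∈ Finset.Ioo s t, (η k * p.G (I k)) ^ 2 :=
        Finset.sum_le_sum_of_subset_of_nonneg (Finset.Ioo_subset_Ioo_right hvt)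
          fun _ _ _ => sq_nonneg _
      set X := ∑ k ∈ Finset.Ioo s t, (η k * p.G (I k)) ^ 2
      have hA : 0 ≤ η s * (p.G (I s) + p.G (I t)) := by positivity
      have hB : 0 ≤ c + X / c := by positivity
      have h3 : 4 * X ≤ (c + X / c) ^ 2 := by
        have : X = c * (X / c) := by field_simp
        nlinarith [sq_nonneg (c - X / c)]
      refine abs_le_of_sq_le_sq' ?_ (by positivity) |>.2
      nlinarith [mul_nonneg hA hB]
  obtain hut' | rfl := Nat.lt_or_eq_of_le hut
  · refine (main u hu (by omega)).trans ?_
    gcongr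
    linarith
  · have h1 := p.step_stability hηt (h.mem_dom hx₁ (by omega) (by omega))
      (h'.mem_dom hx₁ (by omega) (by omega)) (h.2 t (by omega) htT) (h'.2 t (by omega) htT)
    rw [hIt] at h1
    have h2 := main t (by omega) le_rfl
    nlinarith

/-- If the index of a run is changed at step `t`, the iterates up to step `t + 1` move by a
first-order term. -/
theorem IsRun.norm_sub_le_of_forall_lt (h : p.IsRun x₁ T I η x) (h' : p.IsRun x₁ T I' η x')
    (hx₁ : x₁ ∈ dom p.ψ) (hη : ∀ t, 1 ≤ t → t ≤ T → 0 < η t) {t u : ℕ} (ht : 1 ≤ t)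
    (htT : t ≤ T) (hu : 1 ≤ u) (hut : u ≤ t + 1) (hI : ∀ k, 1 ≤ k → k < t → I k = I' k) :
    ‖x u - x' u‖ ≤ η t * (p.G (I t) + p.G (I' t)) := by
  obtain hut' | rfl := Nat.lt_or_eq_of_le hut
  · rw [h.eq_of_forall_lt h' hη hu (by omega) fun k hk hku => hI k hk (by omega), sub_self,
      norm_zero]
    exact mul_nonneg (hη t ht htT).le (add_nonneg (p.G_pos _).le (p.G_pos _).le)
  · have h1 := p.step_stability (hη t ht htT) (h.mem_dom hx₁ ht (by omega))
      (h'.mem_dom hx₁ ht (by omega)) (h.2 t ht htT) (h'.2 t ht htT)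
    rwa [h.eq_of_forall_lt h' hη ht (by omega) fun k hk hkt => hI k hk hkt, sub_self, norm_zero,
      zero_add] at h1

end Runs

end Problem

/-! ### From one-step inequalities to the last iterate -/

/-- If each step satisfies the descent inequality with respect to a fixed reference value `b` and
with respect to every earlier iterate, then the last value is controlled. The suffix averages
`(∑_{t ≥ u} w_t a_{t+1}) / (∑_{t ≥ u} w_t)` are compared for consecutive `u`; nothing is assumed
about the sign of `a t - b`. -/
theorem last_iterate_bound {T : ℕ} (hT : 1 ≤ T) {a w ε D₀ : ℕ → ℝ} {b : ℝ} {D : ℕ → ℕ → ℝ}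
    (hw : ∀ t, 1 ≤ t → t ≤ T → 0 < w t) (hD₀ : 0 ≤ D₀ (T + 1)) (hDself : ∀ u, D u u = 0)
    (hD : ∀ u, 0 ≤ D u (T + 1))
    (h₀ : ∀ t, 1 ≤ t → t ≤ T → w t * (a (t + 1) - b) + D₀ (t + 1) ≤ D₀ t + ε t)
    (h : ∀ u t, 1 ≤ u → u ≤ t → t ≤ T →
      w t * (a (t + 1) - a u) + D u (t + 1) ≤ D u t + ε t) :
    a (T + 1) - b ≤ D₀ 1 / (∑ k ∈ Finset.Icc 1 T, w k) +
      ∑ t ∈ Finset.Icc 1 T, ε t / ∑ k ∈ Finset.Icc t T, w k := by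
  have hsplit : ∀ (φ : ℕ → ℝ) {u : ℕ}, u ≤ T →
      ∑ t ∈ Finset.Icc u T, φ t = φ u + ∑ t ∈ Finset.Icc (u + 1) T, φ t := by
    intro φ u hu
    have e : Finset.Icc u T = insert u (Finset.Icc (u + 1) T) := by ext; simp; omega
    rw [e, Finset.sum_insert (by simp)]
  -- Summing the one-step inequalities with a common reference value `c`.
  have htel : ∀ (c : ℝ) (δ : ℕ → ℝ) {u : ℕ}, 0 ≤ δ (T + 1) → u ≤ T + 1 →
      (∀ t, u ≤ t → t ≤ T → w t * (a (t + 1) - c) + δ (t + 1) ≤ δ t + ε t) →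
      ∑ t ∈ Finset.Icc u T, w t * a (t + 1) - (∑ t ∈ Finset.Icc u T, w t) * c ≤
        δ u + ∑ t ∈ Finset.Icc u T, ε t := by
    intro c δ u hδ hu hstep
    induction hu using Nat.decreasingInduction with
    | self => simpa using hδ
    | of_succ k hk ih =>
      have h1 := ih fun t ht htT => hstep t (by omega) htT
      have h2 := hstep k le_rfl (by omega)
      rw [hsplit _ (by omega), hsplit w (by omega), hsplit ε (by omega)]
      linarith
  have hSpos : ∀ u, 1 ≤ u → u ≤ T → 0 < ∑ t ∈ Finset.Icc u T, w t := fun u hu huT =>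
    Finset.sum_pos (fun t ht => by
      rw [Finset.mem_Icc] at ht; exact hw t (by omega) ht.2) ⟨u, by simp [huT]⟩
  have main : ∀ u, 1 ≤ u → u ≤ T →
      (∑ t ∈ Finset.Icc u T, w t * a (t + 1)) / (∑ t ∈ Finset.Icc u T, w t) ≤
        b + D₀ 1 / (∑ k ∈ Finset.Icc 1 T, w k) +
          (∑ t ∈ Finset.Icc u T, ε t) / (∑ t ∈ Finset.Icc u T, w t) +
          ∑ t ∈ Finset.Ico 1 u, ε t / ∑ k ∈ Finset.Icc t T, w k := by
    intro u hu
    induction u, hu using Nat.le_induction with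
    | base =>
      intro _
      have h1 := htel b D₀ (u := 1) hD₀ (by omega) fun t ht htT => h₀ t ht htT
      have hS := hSpos 1 le_rfl hT
      simp only [Finset.Ico_self, Finset.sum_empty, add_zero]
      rw [add_assoc, ← add_div, ← sub_le_iff_le_add', div_sub' hS.ne']
      gcongr
    | succ k hk ih =>
      intro hkT
      have h1 := ih (by omega)
      have hS := hSpos k hk (by omega)
      have hS' := hSpos (k + 1) (by omega) hkT
      have h2 := htel (a (k + 1)) (D (k + 1)) (u := k + 1) (hD _) (by omega)
        fun t ht htT => h (k + 1) t (by omega) ht htT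
      rw [hDself, zero_add] at h2
      have e : Finset.Ico 1 (k + 1) = insert k (Finset.Ico 1 k) := by ext; simp; omega
      rw [e, Finset.sum_insert (by simp)]
      rw [hsplit _ (by omega : k ≤ T), hsplit ε (by omega : k ≤ T)] at h1
      have hSk := hsplit w (by omega : k ≤ T)
      have hwk := hw k hk (by omega)
      set Q := ∑ t ∈ Finset.Icc (k + 1) T, w t * a (t + 1)
      set R := ∑ t ∈ Finset.Icc (k + 1) T, ε t
      set S' := ∑ t ∈ Finset.Icc (k + 1) T, w t
      set S := ∑ t ∈ Finset.Icc k T, w t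
      have e1 : Q / S' - (w k * a (k + 1) + Q) / S = w k / (S * S') * (Q - S' * a (k + 1)) := by
        rw [hSk] at hS ⊢
        field_simp
        ring
      have e2 : R / S' - R / S = w k / (S * S') * R := by
        rw [hSk] at hS ⊢
        field_simp
        ring
      have h3 : w k / (S * S') * (Q - S' * a (k + 1)) ≤ w k / (S * S') * R := by gcongr
      have e3 : (ε k + R) / S = ε k / S + R / S := add_div _ _ _
      linarith
  have h1 := main T hT le_rfl
  have e : Finset.Icc 1 T = insert T (Finset.Ico 1 T) := by ext; simp; omega
  conv_rhs => enter [2]; rw [e]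
  rw [Finset.sum_insert (by simp)]
  simp only [Finset.Icc_self, Finset.sum_singleton] at h1 ⊢
  rw [mul_div_cancel_left₀ _ (hw T hT le_rfl).ne'] at h1
  linarith

/-! ### Exchangeability inside an epoch -/

theorem epoch_mono {n s t : ℕ} (hst : s ≤ t) : epoch n s ≤ epoch n t := by
  rw [epoch, epoch, Nat.ceilDiv_eq_add_pred_div, Nat.ceilDiv_eq_add_pred_div]
  exact Nat.div_le_div_right (by omega)

theorem epoch_eq_iff {n : ℕ} [NeZero n] {t m : ℕ} (ht : 1 ≤ t) :
    epoch n t = m + 1 ↔ m * n < t ∧ t ≤ m * n + n := by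
  have hn : 0 < n := Nat.pos_of_ne_zero (NeZero.ne n)
  have e : epoch n t = (t - 1) / n + 1 := by
    rw [epoch, Nat.ceilDiv_eq_add_pred_div, show t + n - 1 = (t - 1) + n by omega,
      Nat.add_div_right _ hn]
  rw [e, Nat.add_right_cancel_iff, Nat.div_eq_iff hn]
  omega

/-- The sequences of `K` permutations, one for each of the epochs `1, …, K`. -/
abbrev PermSeq (n K : ℕ) : Type := Finset.Icc 1 K → Equiv.Perm (Fin n)

/-- The coordinates of a sequence of permutations, extended by the identity. -/
def coordPerm {n K : ℕ} (k : ℕ) (τ : PermSeq n K) : Equiv.Perm (Fin n) :=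
  if h : k ∈ Finset.Icc 1 K then τ ⟨k, h⟩ else 1

section Exchange

variable {n K m : ℕ} [NeZero n]

/-- Exchanging two positions of one epoch is a bijection of the sequences of permutations. -/
theorem exists_equiv_rrIndex_swap (hm : m + 1 ≤ K) {s t : ℕ}
    (hs : s ∈ Finset.Ioc (m * n) (m * n + n)) (ht : t ∈ Finset.Ioc (m * n) (m * n + n)) :
    ∃ e : PermSeq n K ≃ PermSeq n K, ∀ τ k, 1 ≤ k →
      rrIndex coordPerm (e τ) k = rrIndex coordPerm τ (Equiv.swap s t k) := by
  classical
  rw [Finset.mem_Ioc] at hs ht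
  have hqK : m + 1 ∈ Finset.Icc 1 K := by simp; omega
  refine ⟨Equiv.piCongrRight fun k => if (k : ℕ) = m + 1 then
    Equiv.mulRight (Equiv.swap (Fin.ofNat n (s - 1)) (Fin.ofNat n (t - 1))) else Equiv.refl _,
    fun τ k hk => ?_⟩
  have hpos : ∀ j, m * n < j → j ≤ m * n + n → (Fin.ofNat n (j - 1) : ℕ) = j - 1 - m * n := by
    intro j h1 h2
    obtain ⟨i, rfl⟩ : ∃ i, j = m * n + i + 1 := ⟨j - m * n - 1, by omega⟩
    simp only [Fin.ofNat, Nat.add_sub_cancel, Nat.add_sub_cancel_left]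
    rw [mul_comm, Nat.mul_add_mod, Nat.mod_eq_of_lt (by omega)]
  have es : epoch n s = m + 1 := (epoch_eq_iff (by omega)).2 hs
  have et : epoch n t = m + 1 := (epoch_eq_iff (by omega)).2 ht
  by_cases hke : epoch n k = m + 1
  · have hk' := (epoch_eq_iff hk).1 hke
    have inj : ∀ j, m * n < j → j ≤ m * n + n → k ≠ j →
        Fin.ofNat n (k - 1) ≠ Fin.ofNat n (j - 1) := by
      intro j h1 h2 hkj heq
      have := congrArg Fin.val heq
      rw [hpos k hk'.1 hk'.2, hpos j h1 h2] at this
      omega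
    have e1 : epoch n (Equiv.swap s t k) = m + 1 := by
      rw [Equiv.swap_apply_def]; split_ifs <;> assumption
    have e2 : Equiv.swap (Fin.ofNat n (s - 1)) (Fin.ofNat n (t - 1)) (Fin.ofNat n (k - 1)) =
        Fin.ofNat n (Equiv.swap s t k - 1) := by
      by_cases hks : k = s
      · subst hks; simp
      · by_cases hkt : k = t
        · subst hkt; simp
        · rw [Equiv.swap_apply_of_ne_of_ne hks hkt,
            Equiv.swap_apply_of_ne_of_ne (inj s hs.1 hs.2 hks) (inj t ht.1 ht.2 hkt)]
    simp only [rrIndex, e1, hke, coordPerm, dif_pos hqK, ← e2]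
    simp
  · have hks : k ≠ s := fun h => hke (h ▸ es)
    have hkt : k ≠ t := fun h => hke (h ▸ et)
    rw [Equiv.swap_apply_of_ne_of_ne hks hkt]
    simp only [rrIndex, coordPerm]
    split_ifs <;> simp [hke]

/-- An epoch visits every index exactly once. -/
theorem sum_rrIndex {Ω : Type*} (π : ℕ → Ω → Equiv.Perm (Fin n)) (ω : Ω) (φ : Fin n → ℝ) :
    ∑ s ∈ Finset.Ioc (m * n) (m * n + n), φ (rrIndex π ω s) = ∑ i, φ i := by
  rw [← Equiv.sum_comp (π (m + 1) ω) φ]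
  symm
  refine Finset.sum_bij (fun (j : Fin n) _ => m * n + j + 1) ?_ ?_ ?_ ?_
  · intro j _
    rw [Finset.mem_Ioc]; omega
  · intro i _ j _ h
    ext; omega
  · intro t ht
    rw [Finset.mem_Ioc] at ht
    exact ⟨⟨t - m * n - 1, by omega⟩, Finset.mem_univ _, by simp only; omega⟩
  · intro j _
    have e1 : epoch n (m * n + j + 1) = m + 1 := (epoch_eq_iff (by omega)).2 (by omega)
    have e2 : Fin.ofNat n (m * n + j + 1 - 1) = j := by
      ext
      simp only [Fin.ofNat, Nat.add_sub_cancel]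
      rw [mul_comm, Nat.mul_add_mod, Nat.mod_eq_of_lt j.2]
    rw [rrIndex, e1, e2]

open scoped BigOperators

/-- Each index is uniformly distributed. -/
theorem expect_rrIndex (hm : m + 1 ≤ K) {s : ℕ} (hs : s ∈ Finset.Ioc (m * n) (m * n + n))
    (φ : Fin n → ℝ) :
    𝔼 τ : PermSeq n K, φ (rrIndex coordPerm τ s) = (1 / (n : ℝ)) * ∑ i, φ i := by
  have hn : (n : ℝ) ≠ 0 := Nat.cast_ne_zero.mpr (NeZero.ne n)
  have h1 : ∀ t ∈ Finset.Ioc (m * n) (m * n + n),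
      𝔼 τ : PermSeq n K, φ (rrIndex coordPerm τ t) =
        𝔼 τ : PermSeq n K, φ (rrIndex coordPerm τ s) := by
    intro t ht
    obtain ⟨e, he⟩ := exists_equiv_rrIndex_swap hm hs ht
    refine Fintype.expect_equiv e _ _ fun τ => ?_
    rw [he τ s (by rw [Finset.mem_Ioc] at hs; omega), Equiv.swap_apply_left]
  have h2 := Finset.sum_congr rfl h1
  rw [← Finset.expect_sum_comm] at h2
  simp only [sum_rrIndex, Finset.sum_const, Nat.card_Ioc, Fintype.expect_const,
    nsmul_eq_mul] at h2
  rw [h2, Nat.add_sub_cancel_left]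
  field_simp

/-- Distinct indices of one epoch are nearly independent: sampling without replacement costs a factor
`n / (n - 1) ≤ 2`. -/
theorem expect_rrIndex_mul_le (hm : m + 1 ≤ K) {s t : ℕ}
    (hs : s ∈ Finset.Ioc (m * n) (m * n + n)) (ht : t ∈ Finset.Ioc (m * n) (m * n + n))
    (hst : s ≠ t) {φ χ : Fin n → ℝ} (hφ : ∀ i, 0 ≤ φ i) (hχ : ∀ i, 0 ≤ χ i) :
    𝔼 τ : PermSeq n K, φ (rrIndex coordPerm τ s) * χ (rrIndex coordPerm τ t) ≤
      2 * ((1 / (n : ℝ)) * ∑ i, φ i) * ((1 / (n : ℝ)) * ∑ i, χ i) := by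
  have hn : (n : ℝ) ≠ 0 := Nat.cast_ne_zero.mpr (NeZero.ne n)
  have h1 : ∀ r ∈ (Finset.Ioc (m * n) (m * n + n)).erase s,
      𝔼 τ : PermSeq n K, φ (rrIndex coordPerm τ s) * χ (rrIndex coordPerm τ r) =
        𝔼 τ : PermSeq n K, φ (rrIndex coordPerm τ s) * χ (rrIndex coordPerm τ t) := by
    intro r hr
    rw [Finset.mem_erase] at hr
    obtain ⟨e, he⟩ := exists_equiv_rrIndex_swap hm ht hr.2
    refine Fintype.expect_equiv e _ _ fun τ => ?_
    rw [he τ s (by rw [Finset.mem_Ioc] at hs; omega), he τ t (by rw [Finset.mem_Ioc] at ht; omega),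
      Equiv.swap_apply_left, Equiv.swap_apply_of_ne_of_ne hst hr.1.symm]
  have h2 := Finset.sum_congr rfl h1
  rw [← Finset.expect_sum_comm] at h2
  have h3 : 𝔼 τ : PermSeq n K, ∑ r ∈ (Finset.Ioc (m * n) (m * n + n)).erase s,
      φ (rrIndex coordPerm τ s) * χ (rrIndex coordPerm τ r) ≤
      𝔼 τ : PermSeq n K, φ (rrIndex coordPerm τ s) * ∑ i, χ i := by
    refine Finset.expect_le_expect fun τ _ => ?_
    rw [← Finset.mul_sum, ← sum_rrIndex (m := m) coordPerm τ χ]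
    exact mul_le_mul_of_nonneg_left (Finset.sum_le_sum_of_subset_of_nonneg
      (Finset.erase_subset _ _) fun _ _ _ => hχ _) (hφ _)
  rw [h2, ← Finset.expect_mul, expect_rrIndex hm hs, Finset.sum_const, Finset.card_erase_of_mem hs,
    Nat.card_Ioc, Nat.add_sub_cancel_left, nsmul_eq_mul] at h3
  have hn2 : 2 ≤ n := by rw [Finset.mem_Ioc] at hs ht; omega
  have hn2' : (2 : ℝ) ≤ n := by exact_mod_cast hn2
  rw [Nat.cast_sub (by omega), Nat.cast_one] at h3
  have h0 : 0 ≤ 𝔼 τ : PermSeq n K, φ (rrIndex coordPerm τ s) * χ (rrIndex coordPerm τ t) :=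
    Finset.expect_nonneg fun τ _ => mul_nonneg (hφ _) (hχ _)
  set X := 𝔼 τ : PermSeq n K, φ (rrIndex coordPerm τ s) * χ (rrIndex coordPerm τ t)
  have h4 : (n : ℝ) / 2 * X ≤ 1 / n * (∑ i, φ i) * ∑ i, χ i :=
    (mul_le_mul_of_nonneg_right (by linarith) h0).trans h3
  have h5 := mul_le_mul_of_nonneg_left h4 (show (0 : ℝ) ≤ 2 / n by positivity)
  have e1 : 2 / (n : ℝ) * (n / 2 * X) = X := by field_simp
  rw [e1] at h5
  refine h5.trans_eq ?_
  ring

end Exchange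

namespace Problem

variable {d n : ℕ}

/-- The mean `f = (1/n) ∑ f_i` of the components. -/
def loss (p : Problem d n) (x : Vec d) : ℝ := (1 / (n : ℝ)) * ∑ i, p.f i x

/-- The quantity `√n G_{f,1} G_{f,2}`, which plays the role of the squared Lipschitz constant in the
rates. -/
def noise (p : Problem d n) : ℝ := Real.sqrt n * p.G1 * p.G2

theorem G2_sq (p : Problem d n) : p.G2 ^ 2 = (1 / (n : ℝ)) * ∑ i, p.G i ^ 2 :=
  Real.sq_sqrt (mul_nonneg (by positivity) (Finset.sum_nonneg fun _ _ => sq_nonneg _))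

theorem G1_pos [NeZero n] (p : Problem d n) : 0 < p.G1 := by
  have hn : 0 < (n : ℝ) := Nat.cast_pos.mpr (Nat.pos_of_ne_zero (NeZero.ne n))
  exact mul_pos (by positivity) (Finset.sum_pos (fun i _ => p.G_pos i) Finset.univ_nonempty)

theorem G2_pos [NeZero n] (p : Problem d n) : 0 < p.G2 := by
  have hn : 0 < (n : ℝ) := Nat.cast_pos.mpr (Nat.pos_of_ne_zero (NeZero.ne n))
  exact Real.sqrt_pos.mpr (mul_pos (by positivity)
    (Finset.sum_pos (fun i _ => pow_pos (p.G_pos i) 2) Finset.univ_nonempty))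

theorem noise_pos [NeZero n] (p : Problem d n) : 0 < p.noise := by
  have hn : 0 < (n : ℝ) := Nat.cast_pos.mpr (Nat.pos_of_ne_zero (NeZero.ne n))
  exact mul_pos (mul_pos (Real.sqrt_pos.mpr hn) p.G1_pos) p.G2_pos

theorem G2_sq_le_noise [NeZero n] (p : Problem d n) : p.G2 ^ 2 ≤ p.noise := by
  have hn : 0 < (n : ℝ) := Nat.cast_pos.mpr (Nat.pos_of_ne_zero (NeZero.ne n))
  have h1 : ∑ i, p.G i ^ 2 ≤ (∑ i, p.G i) ^ 2 :=
    Finset.sum_sq_le_sq_sum_of_nonneg fun i _ => (p.G_pos i).le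
  have h2 : p.G2 ≤ Real.sqrt n * p.G1 := by
    refine Real.sqrt_le_iff.mpr ⟨mul_nonneg (Real.sqrt_nonneg _) p.G1_pos.le, ?_⟩
    rw [mul_pow, Real.sq_sqrt hn.le, G1]
    calc 1 / (n : ℝ) * ∑ i, p.G i ^ 2 ≤ 1 / (n : ℝ) * (∑ i, p.G i) ^ 2 := by gcongr
      _ = n * (1 / (n : ℝ) * ∑ i, p.G i) ^ 2 := by field_simp
  rw [sq, noise]
  exact mul_le_mul_of_nonneg_right h2 p.G2_pos.le

end Problem

/-- Positive stepsizes for steps `1, …, T` that, inside an epoch, are not much larger at earlier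
steps than at later ones. The factor `k - m n` is the position of step `k` in epoch `m + 1`; it lets
the first epoch of `η / √t` be covered, where the stepsizes do vary by a factor `√n`. -/
structure SlowlyVarying (n T : ℕ) (η : ℕ → ℝ) : Prop where
  pos : ∀ t, 1 ≤ t → t ≤ T → 0 < η t
  sq_le : ∀ m k t : ℕ, m * n < k → k ≤ t → t ≤ m * n + n → t ≤ T →
    ((k : ℝ) - m * n) * η k ^ 2 ≤ 2 * n * η t ^ 2
  sum_le : ∀ m t : ℕ, m * n < t → t ≤ m * n + n → t ≤ T →
    ∑ k ∈ Finset.Ioo (m * n) t, η k ≤ 2 * n * η t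

/-! ### The bias of sampling without replacement -/

section Bias

open scoped BigOperators

variable {d n K m T : ℕ} [NeZero n] {p : Problem d n} {x₁ : Vec d} {η : ℕ → ℝ}
  {x : ℕ → PermSeq n K → Vec d}

theorem expect_G (p : Problem d n) (hm : m + 1 ≤ K) {s : ℕ}
    (hs : s ∈ Finset.Ioc (m * n) (m * n + n)) :
    𝔼 τ : PermSeq n K, p.G (rrIndex coordPerm τ s) = p.G1 :=
  expect_rrIndex hm hs p.G

theorem expect_G_sq (p : Problem d n) (hm : m + 1 ≤ K) {s : ℕ}
    (hs : s ∈ Finset.Ioc (m * n) (m * n + n)) :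
    𝔼 τ : PermSeq n K, p.G (rrIndex coordPerm τ s) ^ 2 = p.G2 ^ 2 := by
  rw [p.G2_sq]
  exact expect_rrIndex hm hs fun i => p.G i ^ 2

theorem expect_G_mul_add_le (p : Problem d n) (hm : m + 1 ≤ K) {s t : ℕ}
    (hs : s ∈ Finset.Ioc (m * n) (m * n + n)) (ht : t ∈ Finset.Ioc (m * n) (m * n + n)) :
    𝔼 τ : PermSeq n K, p.G (rrIndex coordPerm τ t) *
      (p.G (rrIndex coordPerm τ s) + p.G (rrIndex coordPerm τ t)) ≤ 2 * p.G2 ^ 2 := by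
  calc _ ≤ 𝔼 τ : PermSeq n K, (2⁻¹ * p.G (rrIndex coordPerm τ s) ^ 2 +
        3 / 2 * p.G (rrIndex coordPerm τ t) ^ 2) :=
        Finset.expect_le_expect fun τ _ => by
          nlinarith [sq_nonneg (p.G (rrIndex coordPerm τ s) - p.G (rrIndex coordPerm τ t))]
    _ = 2 * p.G2 ^ 2 := by
        rw [Finset.expect_add_distrib, ← Finset.mul_expect, ← Finset.mul_expect,
          expect_G_sq p hm hs, expect_G_sq p hm ht]
        ring

theorem expect_G_mul_sum_le (p : Problem d n) (hm : m + 1 ≤ K) {s t : ℕ}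
    (hs : s ∈ Finset.Ioc (m * n) (m * n + n)) (ht : t ∈ Finset.Ioc (m * n) (m * n + n)) :
    𝔼 τ : PermSeq n K, p.G (rrIndex coordPerm τ t) *
      ∑ k ∈ Finset.Ioo s t, (η k * p.G (rrIndex coordPerm τ k)) ^ 2 ≤
      2 * p.G1 * p.G2 ^ 2 * ∑ k ∈ Finset.Ioo s t, η k ^ 2 := by
  simp only [Finset.mul_sum]
  rw [Finset.expect_sum_comm]
  refine Finset.sum_le_sum fun k hk => ?_
  rw [Finset.mem_Ioc] at hs ht
  rw [Finset.mem_Ioo] at hk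
  have h1 := expect_rrIndex_mul_le (K := K) hm (s := t) (t := k) (Finset.mem_Ioc.2 ht)
    (Finset.mem_Ioc.2 (by omega)) (by omega) (φ := p.G) (χ := fun i => p.G i ^ 2)
    (fun i => (p.G_pos i).le) fun i => sq_nonneg _
  rw [← p.G2_sq, ← Problem.G1] at h1
  calc _ = η k ^ 2 * 𝔼 τ : PermSeq n K,
        p.G (rrIndex coordPerm τ t) * p.G (rrIndex coordPerm τ k) ^ 2 := by
        rw [Finset.mul_expect]
        exact Finset.expect_congr rfl fun τ _ => by ring
    _ ≤ η k ^ 2 * (2 * p.G1 * p.G2 ^ 2) := by gcongr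
    _ = _ := by ring

/-- Exchanging steps `s` and `t` of an epoch preserves the law of the permutations and moves the
iterates up to `x_{t+1}` only a little; hence the components drawn at `s` and at `t` have nearly the
same expected value at each of these iterates. The positive number `c` is a free parameter. -/
theorem abs_expect_f_sub_le (hx₁ : x₁ ∈ dom p.ψ) (hη : ∀ t, 1 ≤ t → t ≤ T → 0 < η t)
    (hx : IsRRRun p x₁ T coordPerm η x) (hm : m + 1 ≤ K) {s t u : ℕ}
    (hs : s ∈ Finset.Ioc (m * n) (m * n + n)) (ht : t ∈ Finset.Ioc (m * n) (m * n + n))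
    (htT : t ≤ T) (hu : 1 ≤ u) (hut : u ≤ t + 1) {c : ℝ} (hc : 0 < c) :
    |𝔼 τ, p.f (rrIndex coordPerm τ t) (x u τ) - 𝔼 τ, p.f (rrIndex coordPerm τ s) (x u τ)| ≤
      2 * p.G2 ^ 2 * η t + if s < t then 2 * p.G2 ^ 2 * η s + c * p.G1 +
        2 * p.G1 * p.G2 ^ 2 / c * ∑ k ∈ Finset.Ioo s t, η k ^ 2 else 0 := by
  obtain ⟨e, he⟩ := exists_equiv_rrIndex_swap hm hs ht
  have hs' := Finset.mem_Ioc.1 hs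
  have ht' := Finset.mem_Ioc.1 ht
  have e1 : 𝔼 τ, p.f (rrIndex coordPerm τ s) (x u τ) =
      𝔼 τ, p.f (rrIndex coordPerm τ t) (x u (e τ)) := by
    symm
    refine Fintype.expect_equiv e _ _ fun τ => ?_
    rw [he τ s (by omega), Equiv.swap_apply_left]
  rw [e1, ← Finset.expect_sub_distrib]
  have h1 : |𝔼 τ, (p.f (rrIndex coordPerm τ t) (x u τ) -
      p.f (rrIndex coordPerm τ t) (x u (e τ)))| ≤
      𝔼 τ, p.G (rrIndex coordPerm τ t) * ‖x u τ - x u (e τ)‖ :=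
    (Finset.abs_expect_le _ _).trans (Finset.expect_le_expect fun τ _ =>
      p.f_lipschitz _ _ ((hx τ).mem_dom hx₁ hu (by omega)) _
        ((hx (e τ)).mem_dom hx₁ hu (by omega)))
  refine h1.trans ?_
  split_ifs with hst
  · have h2 : ∀ τ, ‖x u τ - x u (e τ)‖ ≤
        (η s + η t) * (p.G (rrIndex coordPerm τ s) + p.G (rrIndex coordPerm τ t)) +
        (c + (∑ k ∈ Finset.Ioo s t, (η k * p.G (rrIndex coordPerm τ k)) ^ 2) / c) := by
      intro τ
      refine (hx τ).norm_sub_le_of_swap (hx (e τ)) hx₁ hη (by omega) hst htT hu hut ?_ ?_ ?_ hc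
      · intro k hk hkt hks
        rw [he τ k hk, Equiv.swap_apply_of_ne_of_ne hks (by omega)]
      · rw [he τ s (by omega), Equiv.swap_apply_left]
      · rw [he τ t (by omega), Equiv.swap_apply_right]
    calc _ ≤ 𝔼 τ, ((η s + η t) * (p.G (rrIndex coordPerm τ t) *
          (p.G (rrIndex coordPerm τ s) + p.G (rrIndex coordPerm τ t))) +
          c * p.G (rrIndex coordPerm τ t) + 1 / c * (p.G (rrIndex coordPerm τ t) *
            ∑ k ∈ Finset.Ioo s t, (η k * p.G (rrIndex coordPerm τ k)) ^ 2)) :=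
          Finset.expect_le_expect fun τ _ => by
            refine (mul_le_mul_of_nonneg_left (h2 τ) (p.G_pos _).le).trans_eq ?_
            ring
      _ ≤ (η s + η t) * (2 * p.G2 ^ 2) + c * p.G1 +
          1 / c * (2 * p.G1 * p.G2 ^ 2 * ∑ k ∈ Finset.Ioo s t, η k ^ 2) := by
          have h3 := hη s (by omega) (by omega)
          have h4 := hη t (by omega) htT
          rw [Finset.expect_add_distrib, Finset.expect_add_distrib, ← Finset.mul_expect,
            ← Finset.mul_expect, ← Finset.mul_expect, expect_G p hm ht]
          gcongr
          · exact expect_G_mul_add_le p hm hs ht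
          · exact expect_G_mul_sum_le p hm hs ht
      _ = _ := by ring
  · have h2 : ∀ τ, ‖x u τ - x u (e τ)‖ ≤
        η t * (p.G (rrIndex coordPerm τ s) + p.G (rrIndex coordPerm τ t)) := by
      intro τ
      have h3 := (hx τ).norm_sub_le_of_forall_lt (hx (e τ)) hx₁ hη (t := t) (by omega) htT hu hut
        fun k hk hkt => by
          rw [he τ k hk, Equiv.swap_apply_of_ne_of_ne (by omega) (by omega)]
      rwa [he τ t (by omega), Equiv.swap_apply_right, add_comm (p.G _)] at h3
    calc _ ≤ 𝔼 τ, η t * (p.G (rrIndex coordPerm τ t) *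
          (p.G (rrIndex coordPerm τ s) + p.G (rrIndex coordPerm τ t))) :=
          Finset.expect_le_expect fun τ _ => by
            refine (mul_le_mul_of_nonneg_left (h2 τ) (p.G_pos _).le).trans_eq ?_
            ring
      _ ≤ η t * (2 * p.G2 ^ 2) := by
          rw [← Finset.mul_expect]
          exact mul_le_mul_of_nonneg_left (expect_G_mul_add_le p hm hs ht)
            (hη t (by omega) htT).le
      _ = _ := by ring

/-- At every iterate up to `x_{t+1}`, the component drawn at step `t` has nearly the expected value
of the mean `(1/n) ∑ f_i`. -/
theorem abs_expect_f_sub_loss_le (hx₁ : x₁ ∈ dom p.ψ) (hη : SlowlyVarying n T η)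
    (hx : IsRRRun p x₁ T coordPerm η x) (hm : m + 1 ≤ K) {t u : ℕ}
    (ht : t ∈ Finset.Ioc (m * n) (m * n + n)) (htT : t ≤ T) (hu : 1 ≤ u) (hut : u ≤ t + 1) :
    |𝔼 τ, p.f (rrIndex coordPerm τ t) (x u τ) - 𝔼 τ, p.loss (x u τ)| ≤
      11 * p.noise * η t := by
  have hn : 0 < (n : ℝ) := Nat.cast_pos.mpr (Nat.pos_of_ne_zero (NeZero.ne n))
  have ht' := Finset.mem_Ioc.1 ht
  have hηt := hη.pos t (by omega) htT
  have hG1 := p.G1_pos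
  have hG2 := p.G2_pos
  have hV := p.G2_sq_le_noise
  set B := Finset.Ioc (m * n) (m * n + n) with hB
  have hcard : (B.card : ℝ) = n := by rw [hB, Nat.card_Ioc, Nat.add_sub_cancel_left]
  have e1 : n * (𝔼 τ, p.f (rrIndex coordPerm τ t) (x u τ) - 𝔼 τ, p.loss (x u τ)) =
      ∑ s ∈ B, (𝔼 τ, p.f (rrIndex coordPerm τ t) (x u τ) -
        𝔼 τ, p.f (rrIndex coordPerm τ s) (x u τ)) := by
    rw [Finset.sum_sub_distrib, Finset.sum_const, nsmul_eq_mul, hcard, ← Finset.expect_sum_comm,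
      mul_sub]
    congr 1
    rw [Finset.mul_expect]
    refine Finset.expect_congr rfl fun τ _ => ?_
    rw [hB, sum_rrIndex coordPerm τ fun i => p.f i (x u τ), Problem.loss]
    field_simp
  -- This choice of the free parameter balances the two terms that it enters.
  set c := Real.sqrt n * η t * p.G2 with hc
  have hsn : 0 < Real.sqrt n := Real.sqrt_pos.mpr hn
  have hcpos : 0 < c := by positivity
  have hfilter : B.filter (fun s => s < t) = Finset.Ioo (m * n) t := by
    ext s; simp only [hB, Finset.mem_filter, Finset.mem_Ioc, Finset.mem_Ioo]; omega
  have hcard' : ((Finset.Ioo (m * n) t).card : ℝ) ≤ n := by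
    rw [Nat.card_Ioo]; exact_mod_cast (by omega : t - m * n - 1 ≤ n)
  have hdouble : ∑ s ∈ Finset.Ioo (m * n) t, ∑ k ∈ Finset.Ioo s t, η k ^ 2 ≤
      2 * n ^ 2 * η t ^ 2 := by
    have h1 : ∑ s ∈ Finset.Ioo (m * n) t, ∑ k ∈ Finset.Ioo s t, η k ^ 2 =
        ∑ k ∈ Finset.Ioo (m * n) t, ∑ s ∈ Finset.Ioo (m * n) k, η k ^ 2 :=
      Finset.sum_comm' fun s k => by simp only [Finset.mem_Ioo]; omega
    rw [h1]
    calc _ ≤ ∑ k ∈ Finset.Ioo (m * n) t, 2 * n * η t ^ 2 := by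
          refine Finset.sum_le_sum fun k hk => ?_
          rw [Finset.mem_Ioo] at hk
          refine le_trans ?_ (hη.sq_le m k t hk.1 hk.2.le ht'.2 htT)
          rw [Finset.sum_const, nsmul_eq_mul]
          refine mul_le_mul_of_nonneg_right ?_ (sq_nonneg _)
          rw [Nat.card_Ioo, le_sub_iff_add_le]
          exact_mod_cast (by omega : k - m * n - 1 + m * n ≤ k)
      _ ≤ n * (2 * n * η t ^ 2) := by
          rw [Finset.sum_const, nsmul_eq_mul]
          exact mul_le_mul_of_nonneg_right hcard' (by positivity)
      _ = _ := by ring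
  have h1 : n * |𝔼 τ, p.f (rrIndex coordPerm τ t) (x u τ) - 𝔼 τ, p.loss (x u τ)| ≤
      n * (11 * p.noise * η t) := by
    calc _ = |∑ s ∈ B, (𝔼 τ, p.f (rrIndex coordPerm τ t) (x u τ) -
          𝔼 τ, p.f (rrIndex coordPerm τ s) (x u τ))| := by
          rw [← e1, abs_mul, abs_of_pos hn]
      _ ≤ ∑ s ∈ B, (2 * p.G2 ^ 2 * η t + if s < t then 2 * p.G2 ^ 2 * η s + c * p.G1 +
          2 * p.G1 * p.G2 ^ 2 / c * ∑ k ∈ Finset.Ioo s t, η k ^ 2 else 0) :=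
          (Finset.abs_sum_le_sum_abs _ _).trans (Finset.sum_le_sum fun s hs =>
            abs_expect_f_sub_le hx₁ hη.pos hx hm hs ht htT hu hut hcpos)
      _ = n * (2 * p.G2 ^ 2 * η t) + (2 * p.G2 ^ 2 * ∑ s ∈ Finset.Ioo (m * n) t, η s +
          (Finset.Ioo (m * n) t).card * (c * p.G1) + 2 * p.G1 * p.G2 ^ 2 / c *
          ∑ s ∈ Finset.Ioo (m * n) t, ∑ k ∈ Finset.Ioo s t, η k ^ 2) := by
          rw [Finset.sum_add_distrib, Finset.sum_const, nsmul_eq_mul, hcard,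
            ← Finset.sum_filter, hfilter, Finset.sum_add_distrib, Finset.sum_add_distrib,
            Finset.sum_const, nsmul_eq_mul, Finset.mul_sum, Finset.mul_sum]
      _ ≤ n * (2 * p.G2 ^ 2 * η t) + (2 * p.G2 ^ 2 * (2 * n * η t) + n * (c * p.G1) +
          2 * p.G1 * p.G2 ^ 2 / c * (2 * n ^ 2 * η t ^ 2)) := by
          gcongr
          exact hη.sum_le m t ht'.1 ht'.2 htT
      _ = n * (6 * p.G2 ^ 2 * η t + 5 * p.noise * η t) := by
          have e2 : 2 * p.G1 * p.G2 ^ 2 / c * (2 * n ^ 2 * η t ^ 2) =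
              4 * n * (p.noise * η t) := by
            rw [hc, Problem.noise, div_mul_eq_mul_div, div_eq_iff (by positivity)]
            have := Real.mul_self_sqrt hn.le
            linear_combination (-4 * n * p.G1 * p.G2 ^ 2 * η t ^ 2) * this
          rw [e2, hc, Problem.noise]
          ring
      _ ≤ _ := by
          refine mul_le_mul_of_nonneg_left ?_ hn.le
          nlinarith
  exact le_of_mul_le_mul_left h1 hn

/-! ### The expected last iterate -/

theorem exists_epoch_start {t : ℕ} (ht : 1 ≤ t) :
    ∃ m, epoch n t = m + 1 ∧ t ∈ Finset.Ioc (m * n) (m * n + n) := by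
  have hn : 0 < n := Nat.pos_of_ne_zero (NeZero.ne n)
  have h : (t - 1) / n * n < t ∧ t ≤ (t - 1) / n * n + n := by
    have h1 := Nat.div_add_mod (t - 1) n
    have h2 := Nat.mod_lt (t - 1) hn
    rw [mul_comm] at h1
    omega
  exact ⟨(t - 1) / n, (epoch_eq_iff ht).2 h, Finset.mem_Ioc.2 h⟩

/-- The error of the last iterate for general stepsizes. -/
theorem expect_last_iterate_le (hT : 1 ≤ T) (hTK : epoch n T ≤ K) (hx₁ : x₁ ∈ dom p.ψ)
    (hη : SlowlyVarying n T η) (hx : IsRRRun p x₁ T coordPerm η x) {z : Vec d}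
    (hz : z ∈ dom p.ψ) :
    𝔼 τ, (p.loss (x (T + 1) τ) + p.reg (x (T + 1) τ)) - (p.loss z + p.reg z) ≤
      ‖z - x₁‖ ^ 2 / 2 / (∑ k ∈ Finset.Icc 1 T, η k) +
      24 * p.noise * ∑ t ∈ Finset.Icc 1 T, η t ^ 2 / ∑ k ∈ Finset.Icc t T, η k := by
  have hstep : ∀ (t : ℕ) (y : PermSeq n K → Vec d), 1 ≤ t → t ≤ T → (∀ τ, y τ ∈ dom p.ψ) →
      |𝔼 τ, p.f (rrIndex coordPerm τ t) (y τ) - 𝔼 τ, p.loss (y τ)| ≤ 11 * p.noise * η t →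
      η t * (𝔼 τ, (p.loss (x (t + 1) τ) + p.reg (x (t + 1) τ)) -
        𝔼 τ, (p.loss (y τ) + p.reg (y τ))) + 𝔼 τ, ‖x (t + 1) τ - y τ‖ ^ 2 / 2 ≤
        𝔼 τ, ‖x t τ - y τ‖ ^ 2 / 2 + 24 * p.noise * η t ^ 2 := by
    intro t y ht htT hy hb
    obtain ⟨m, hme, hm⟩ := exists_epoch_start (n := n) ht
    have hmK : m + 1 ≤ K := hme ▸ (epoch_mono htT).trans hTK
    have hηt := hη.pos t ht htT
    have h1 := Finset.expect_le_expect (s := Finset.univ) fun τ (_ : τ ∈ Finset.univ) =>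
      p.step_descent hηt ((hx τ).mem_dom hx₁ ht (by omega)) ((hx τ).2 t ht htT) (hy τ)
    simp only [Finset.expect_add_distrib, ← Finset.mul_expect, Finset.expect_sub_distrib,
      mul_pow] at h1 ⊢
    rw [expect_G_sq p hmK hm] at h1
    have h2 := (abs_le.1 (abs_expect_f_sub_loss_le hx₁ hη hx hmK hm htT
      (u := t + 1) (by omega) le_rfl)).1
    have h3 := (abs_le.1 hb).2
    have h4 := p.G2_sq_le_noise
    nlinarith [mul_le_mul_of_nonneg_left h4 (sq_nonneg (η t)),
      mul_le_mul_of_nonneg_left h2 hηt.le, mul_le_mul_of_nonneg_left h3 hηt.le]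
  have h := last_iterate_bound hT (a := fun t => 𝔼 τ, (p.loss (x t τ) + p.reg (x t τ))) (w := η)
    (ε := fun t => 24 * p.noise * η t ^ 2) (D₀ := fun t => 𝔼 τ, ‖x t τ - z‖ ^ 2 / 2)
    (b := p.loss z + p.reg z) (D := fun u t => 𝔼 τ, ‖x t τ - x u τ‖ ^ 2 / 2) hη.pos
    (Finset.expect_nonneg fun _ _ => by positivity) (fun u => by simp)
    (fun u => Finset.expect_nonneg fun _ _ => by positivity) ?_ ?_
  · have e1 : 𝔼 τ, ‖x 1 τ - z‖ ^ 2 / 2 = ‖z - x₁‖ ^ 2 / 2 := by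
      have hx1 : ∀ τ, x 1 τ = x₁ := fun τ => (hx τ).1
      simp only [hx1, norm_sub_rev x₁ z, Fintype.expect_const]
    simp only [mul_div_assoc, ← Finset.mul_sum] at h e1 ⊢
    rwa [e1] at h
  · intro t ht htT
    have h1 := hstep t (fun _ => z) ht htT (fun _ => hz) ?_
    · rwa [Fintype.expect_const] at h1
    · obtain ⟨m, hme, hm⟩ := exists_epoch_start (n := n) ht
      have hmK : m + 1 ≤ K := hme ▸ (epoch_mono htT).trans hTK
      rw [expect_rrIndex hmK hm fun i => p.f i z, Fintype.expect_const, Problem.loss, sub_self,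
        abs_zero]
      exact mul_nonneg (mul_nonneg (by norm_num) p.noise_pos.le) (hη.pos t ht htT).le
  · intro u t hu hut htT
    obtain ⟨m, hme, hm⟩ := exists_epoch_start (n := n) (t := t) (by omega)
    have hmK : m + 1 ≤ K := hme ▸ (epoch_mono htT).trans hTK
    exact hstep t (x u) (by omega) htT (fun τ => (hx τ).mem_dom hx₁ hu (by omega))
      (abs_expect_f_sub_loss_le hx₁ hη hx hmK hm htT hu (by omega))

end Bias

/-! ### The three stepsizes -/

section Stepsizes

variable {n T : ℕ} {η : ℝ}

theorem sum_Icc_reflect (T : ℕ) (φ : ℕ → ℝ) :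
    ∑ t ∈ Finset.Icc 1 T, φ (T + 1 - t) = ∑ t ∈ Finset.Icc 1 T, φ t :=
  Finset.sum_nbij' (fun t => T + 1 - t) (fun t => T + 1 - t)
    (fun t ht => by rw [Finset.mem_Icc] at *; omega) (fun t ht => by rw [Finset.mem_Icc] at *; omega)
    (fun t ht => by rw [Finset.mem_Icc] at ht; omega)
    (fun t ht => by rw [Finset.mem_Icc] at ht; omega) fun _ _ => rfl

theorem sum_inv_le_one_add_log (T : ℕ) :
    ∑ t ∈ Finset.Icc 1 T, (t : ℝ)⁻¹ ≤ 1 + Real.log T := by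
  have h := harmonic_le_one_add_log T
  rw [harmonic_eq_sum_Icc] at h
  push_cast at h
  exact h

theorem slowlyVarying_of_const_on_epochs {w : ℕ → ℝ} (hpos : ∀ t, 1 ≤ t → t ≤ T → 0 < w t)
    (hconst : ∀ m k t : ℕ, m * n < k → k ≤ t → t ≤ m * n + n → w k = w t) :
    SlowlyVarying n T w := by
  refine ⟨hpos, fun m k t h1 h2 h3 h4 => ?_, fun m t h1 h2 h3 => ?_⟩
  · rw [hconst m k t h1 h2 h3]
    refine mul_le_mul_of_nonneg_right ?_ (sq_nonneg _)
    have : (k : ℝ) ≤ m * n + n := by exact_mod_cast h2.trans h3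
    have : (0 : ℝ) ≤ n := Nat.cast_nonneg n
    linarith
  · have hwt := hpos t (by omega) h3
    rw [Finset.sum_congr rfl fun k hk => hconst m k t (Finset.mem_Ioo.1 hk).1
      (Finset.mem_Ioo.1 hk).2.le h2, Finset.sum_const, nsmul_eq_mul, Nat.card_Ioo]
    refine mul_le_mul_of_nonneg_right ?_ hwt.le
    have : ((t - m * n - 1 : ℕ) : ℝ) ≤ n := by exact_mod_cast (by omega : t - m * n - 1 ≤ n)
    have : (0 : ℝ) ≤ n := Nat.cast_nonneg n
    linarith

theorem slowlyVarying_stepConst (hT : 1 ≤ T) (hη : 0 < η) :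
    SlowlyVarying n T (stepConst T η) :=
  slowlyVarying_of_const_on_epochs (fun _ _ _ => div_pos hη (by positivity))
    fun _ _ _ _ _ _ => rfl

theorem slowlyVarying_stepEpochDecay [NeZero n] (hT : 1 ≤ T) (hη : 0 < η) :
    SlowlyVarying n T (stepEpochDecay n T η) := by
  refine slowlyVarying_of_const_on_epochs (fun t ht htT => ?_) fun m k t h1 h2 h3 => ?_
  · have h1 : (epoch n t : ℝ) ≤ epoch n T := by exact_mod_cast epoch_mono htT
    obtain ⟨m, hm, -⟩ := exists_epoch_start (n := n) hT
    have h2 : (0 : ℝ) < epoch n T := by rw [hm]; positivity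
    have h3 : (0 : ℝ) < T := by exact_mod_cast hT
    have h4 : (0 : ℝ) < (epoch n T : ℝ) - epoch n t + 1 := by linarith
    rw [stepEpochDecay]
    positivity
  · rw [stepEpochDecay, stepEpochDecay, (epoch_eq_iff (by omega)).2 ⟨h1, by omega⟩,
      (epoch_eq_iff (t := t) (m := m) (by omega)).2 ⟨by omega, h3⟩]

theorem sum_inv_sqrt_le {a b : ℕ} (hab : a ≤ b) :
    ∑ k ∈ Finset.Ioc a b, 1 / Real.sqrt k ≤ 2 * (Real.sqrt b - Real.sqrt a) := by
  induction b, hab using Nat.le_induction with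
  | base => simp
  | succ b hb ih =>
    have e : Finset.Ioc a (b + 1) = insert (b + 1) (Finset.Ioc a b) := by ext; simp; omega
    rw [e, Finset.sum_insert (by simp)]
    have h1 : 0 < Real.sqrt ((b + 1 : ℕ) : ℝ) := Real.sqrt_pos.mpr (by positivity)
    have h2 := Real.sq_sqrt (Nat.cast_nonneg (α := ℝ) (b + 1))
    have h3 := Real.sq_sqrt (Nat.cast_nonneg (α := ℝ) b)
    have h4 : 1 / Real.sqrt ((b + 1 : ℕ) : ℝ) ≤
        2 * (Real.sqrt ((b + 1 : ℕ) : ℝ) - Real.sqrt b) := by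
      rw [div_le_iff₀ h1]
      push_cast at *
      nlinarith [sq_nonneg (Real.sqrt ((b : ℝ) + 1) - Real.sqrt b)]
    linarith

theorem slowlyVarying_stepSqrt (hη : 0 < η) : SlowlyVarying n T (stepSqrt η) := by
  refine ⟨fun t ht _ => div_pos hη (by positivity), fun m k t h1 h2 h3 _ => ?_,
    fun m t h1 h2 _ => ?_⟩
  · have hk : (0 : ℝ) < k := by exact_mod_cast (by omega : 0 < k)
    have ht : (0 : ℝ) < t := by exact_mod_cast (by omega : 0 < t)
    simp only [stepSqrt, div_pow, Real.sq_sqrt hk.le, Real.sq_sqrt ht.le]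
    rw [← mul_div_assoc, ← mul_div_assoc, div_le_div_iff₀ hk ht]
    have h4 : ((m * n : ℕ) : ℝ) ≤ k := by exact_mod_cast h1.le
    have h5 : (t : ℝ) ≤ ((m * n : ℕ) : ℝ) + n := by exact_mod_cast h3
    have h6 : (k : ℝ) ≤ ((m * n : ℕ) : ℝ) + n := by exact_mod_cast h2.trans h3
    have h7 : (0 : ℝ) ≤ n := Nat.cast_nonneg n
    have h8 : (0 : ℝ) ≤ ((m * n : ℕ) : ℝ) := Nat.cast_nonneg _
    rw [← Nat.cast_mul]
    set a : ℝ := ((m * n : ℕ) : ℝ)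
    have h9 : (k - a) * t ≤ 2 * n * k :=
      calc (k - a) * t ≤ (k - a) * (a + n) := by gcongr
        _ ≤ 2 * n * k := by nlinarith [mul_le_mul_of_nonneg_right h4 h7]
    nlinarith [mul_le_mul_of_nonneg_left h9 (sq_nonneg η)]
  · have ht : (0 : ℝ) < t := by exact_mod_cast (by omega : 0 < t)
    have hs := Real.sqrt_pos.mpr ht
    have h3 : ∑ k ∈ Finset.Ioo (m * n) t, stepSqrt η k ≤
        η * (2 * (Real.sqrt t - Real.sqrt ((m * n : ℕ) : ℝ))) := by
      calc _ ≤ ∑ k ∈ Finset.Ioc (m * n) t, η * (1 / Real.sqrt k) := by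
            simp only [stepSqrt, mul_one_div]
            exact Finset.sum_le_sum_of_subset_of_nonneg Finset.Ioo_subset_Ioc_self
              fun _ _ _ => div_nonneg hη.le (Real.sqrt_nonneg _)
        _ ≤ _ := by
            rw [← Finset.mul_sum]
            exact mul_le_mul_of_nonneg_left (sum_inv_sqrt_le h1.le) hη.le
    refine h3.trans ?_
    rw [stepSqrt, mul_comm η, ← mul_div_assoc, le_div_iff₀ hs]
    have h4 : Real.sqrt ((m * n : ℕ) : ℝ) ≤ Real.sqrt t :=
      Real.sqrt_le_sqrt (by exact_mod_cast h1.le)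
    have h5 := Real.mul_self_sqrt ht.le
    have h6 := Real.mul_self_sqrt (Nat.cast_nonneg (α := ℝ) (m * n))
    have h7 : (t : ℝ) ≤ ((m * n : ℕ) : ℝ) + n := by exact_mod_cast h2
    have h8 := Real.sqrt_nonneg ((m * n : ℕ) : ℝ)
    have h9 : (Real.sqrt t - Real.sqrt ((m * n : ℕ) : ℝ)) * Real.sqrt t ≤ n := by nlinarith
    nlinarith

/-- What the last iterate requires of a stepsize `w`, in terms of the scale `η` and the logarithmic
factor `l`. -/
structure StepsizeRate (T : ℕ) (w : ℕ → ℝ) (η l : ℝ) : Prop where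
  le_sum : η * Real.sqrt T / 2 ≤ ∑ k ∈ Finset.Icc 1 T, w k
  sum_le : ∑ t ∈ Finset.Icc 1 T, w t ^ 2 / ∑ k ∈ Finset.Icc t T, w k ≤
    40 * (η * l / Real.sqrt T)

theorem stepsizeRate_stepConst (hT : 1 ≤ T) (hη : 0 < η) :
    StepsizeRate T (stepConst T η) η (1 + Real.log T) := by
  have hT' : (0 : ℝ) < T := by exact_mod_cast hT
  have hs := Real.sqrt_pos.mpr hT'
  have hss := Real.mul_self_sqrt hT'.le
  have hl : 0 ≤ Real.log T := Real.log_natCast_nonneg T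
  constructor
  · simp only [stepConst, Finset.sum_const, Nat.card_Icc, nsmul_eq_mul, Nat.add_sub_cancel]
    rw [← mul_div_assoc, le_div_iff₀ hs]
    nlinarith
  · have h1 : ∀ t ∈ Finset.Icc 1 T, stepConst T η t ^ 2 / ∑ k ∈ Finset.Icc t T, stepConst T η k =
        η / Real.sqrt T * ((T + 1 - t : ℕ) : ℝ)⁻¹ := by
      intro t ht
      rw [Finset.mem_Icc] at ht
      have : (0 : ℝ) < ((T + 1 - t : ℕ) : ℝ) := by exact_mod_cast (by omega : 0 < T + 1 - t)
      simp only [stepConst, Finset.sum_const, Nat.card_Icc, nsmul_eq_mul]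
      field_simp
    rw [Finset.sum_congr rfl h1, ← Finset.mul_sum, sum_Icc_reflect T fun t => (t : ℝ)⁻¹]
    calc _ ≤ η / Real.sqrt T * (1 + Real.log T) := by gcongr; exact sum_inv_le_one_add_log T
      _ ≤ 40 * (η / Real.sqrt T * (1 + Real.log T)) :=
          le_mul_of_one_le_left (by positivity) (by norm_num)
      _ = _ := by ring

theorem stepsizeRate_stepSqrt (hT : 1 ≤ T) (hη : 0 < η) :
    StepsizeRate T (stepSqrt η) η (1 + Real.log T) := by
  have hT' : (0 : ℝ) < T := by exact_mod_cast hT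
  have hs := Real.sqrt_pos.mpr hT'
  have hss := Real.mul_self_sqrt hT'.le
  have hl : 0 ≤ Real.log T := Real.log_natCast_nonneg T
  have hS : ∀ t, 1 ≤ t → ((T + 1 - t : ℕ) : ℝ) * (η / Real.sqrt T) ≤
      ∑ k ∈ Finset.Icc t T, stepSqrt η k := by
    intro t ht
    rw [← Nat.card_Icc, ← nsmul_eq_mul]
    refine Finset.card_nsmul_le_sum _ _ _ fun k hk => ?_
    rw [Finset.mem_Icc] at hk
    have : (0 : ℝ) < k := by exact_mod_cast (by omega : 0 < k)
    rw [stepSqrt]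
    gcongr
    exact hk.2
  constructor
  · refine le_trans ?_ (hS 1 le_rfl)
    rw [Nat.add_sub_cancel, ← mul_div_assoc, le_div_iff₀ hs]
    nlinarith
  · have h1 : ∀ t ∈ Finset.Icc 1 T, stepSqrt η t ^ 2 / ∑ k ∈ Finset.Icc t T, stepSqrt η k ≤
        η / Real.sqrt T * ((t : ℝ)⁻¹ + ((T + 1 - t : ℕ) : ℝ)⁻¹) := by
      intro t ht
      rw [Finset.mem_Icc] at ht
      have h2 : (0 : ℝ) < ((T + 1 - t : ℕ) : ℝ) := by exact_mod_cast (by omega : 0 < T + 1 - t)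
      have h3 : (0 : ℝ) < t := by exact_mod_cast ht.1
      have h4 : ((T + 1 - t : ℕ) : ℝ) + t = T + 1 := by
        exact_mod_cast (by omega : T + 1 - t + t = T + 1)
      have h5 : 0 < ((T + 1 - t : ℕ) : ℝ) * (η / Real.sqrt T) := by positivity
      calc _ ≤ stepSqrt η t ^ 2 / (((T + 1 - t : ℕ) : ℝ) * (η / Real.sqrt T)) := by
            gcongr; exact hS t ht.1
        _ = η / Real.sqrt T * (T / (t * ((T + 1 - t : ℕ) : ℝ))) := by
            rw [stepSqrt, div_pow, Real.sq_sqrt h3.le]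
            field_simp
            linear_combination hss
        _ ≤ η / Real.sqrt T * ((((T + 1 - t : ℕ) : ℝ) + t) / (t * ((T + 1 - t : ℕ) : ℝ))) := by
            gcongr; linarith
        _ = _ := by field_simp
    refine (Finset.sum_le_sum h1).trans ?_
    rw [← Finset.mul_sum, Finset.sum_add_distrib, sum_Icc_reflect T fun t => (t : ℝ)⁻¹]
    have h2 := sum_inv_le_one_add_log T
    calc _ ≤ η / Real.sqrt T * ((1 + Real.log T) + (1 + Real.log T)) := by gcongr
      _ = 2 * (η / Real.sqrt T * (1 + Real.log T)) := by ring
      _ ≤ 40 * (η / Real.sqrt T * (1 + Real.log T)) := by gcongr; norm_num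
      _ = _ := by ring

/-- With epoch-decaying steps only the last `2 n` steps, in which the stepsize is at most `4` times
its final value, contribute a logarithm; each earlier step contributes at most a fraction `8 / T` of
`η / √T`. -/
theorem stepsizeRate_stepEpochDecay [NeZero n] (hT : 1 ≤ T) (hη : 0 < η) :
    StepsizeRate T (stepEpochDecay n T η) η (1 + Real.log n / (epoch n T : ℝ)) := by
  have hT' : (0 : ℝ) < T := by exact_mod_cast hT
  have hn : 0 < (n : ℝ) := Nat.cast_pos.mpr (Nat.pos_of_ne_zero (NeZero.ne n))
  have hs := Real.sqrt_pos.mpr hT'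
  have hss := Real.mul_self_sqrt hT'.le
  obtain ⟨M, hM, hMT⟩ := exists_epoch_start (n := n) hT
  rw [Finset.mem_Ioc] at hMT
  have hK : (0 : ℝ) < epoch n T := by rw [hM]; positivity
  have hK1 : (1 : ℝ) ≤ epoch n T := by rw [hM]; push_cast; linarith [Nat.cast_nonneg (α := ℝ) M]
  set K : ℝ := (epoch n T : ℝ) with hKdef
  have hKn : (T : ℝ) ≤ K * n := by
    rw [hKdef, hM]
    have : (T : ℝ) ≤ M * n + n := by exact_mod_cast hMT.2
    push_cast; linarith
  have hl : 0 ≤ Real.log n := Real.log_natCast_nonneg n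
  set h := η / Real.sqrt T with hh
  have hhpos : 0 < h := by positivity
  -- Here `j` is the number of epochs that remain at step `t`, the current one included, and
  -- `T + 1 - t` is the number of remaining steps; `K n - T` steps are missing from the last epoch.
  have hw : ∀ t, 1 ≤ t → t ≤ T → ∃ j : ℝ, stepEpochDecay n T η t = h * (j / K) ∧ 1 ≤ j ∧
      ((T + 1 - t : ℕ) : ℝ) + (K * n - T) ≤ j * n ∧ j * n ≤ ((T + 1 - t : ℕ) : ℝ) + 2 * n := by
    intro t ht htT
    obtain ⟨m, hm, hmt⟩ := exists_epoch_start (n := n) ht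
    rw [Finset.mem_Ioc] at hmt
    have hmM : m ≤ M := by
      have := epoch_mono (n := n) htT
      omega
    have hmM' : (m : ℝ) ≤ M := by exact_mod_cast hmM
    have h1 : (m : ℝ) * n + 1 ≤ t := by exact_mod_cast hmt.1
    have h2 : (t : ℝ) ≤ m * n + n := by exact_mod_cast hmt.2
    have h3 : (M : ℝ) * n + 1 ≤ T := by exact_mod_cast hMT.1
    have h4 : (T : ℝ) ≤ M * n + n := by exact_mod_cast hMT.2
    refine ⟨K - epoch n t + 1, ?_, ?_⟩
    · rw [stepEpochDecay, hh, ← hKdef]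
      field_simp
    · rw [Nat.cast_sub (by omega), hm, hKdef, hM]
      push_cast
      refine ⟨by linarith, by nlinarith, by nlinarith⟩
  have hS1 : ∀ t, 1 ≤ t → t ≤ T → ((T + 1 - t : ℕ) : ℝ) * (h / K) ≤
      ∑ k ∈ Finset.Icc t T, stepEpochDecay n T η k := by
    intro t ht htT
    rw [← Nat.card_Icc, ← nsmul_eq_mul]
    refine Finset.card_nsmul_le_sum _ _ _ fun k hk => ?_
    rw [Finset.mem_Icc] at hk
    obtain ⟨j, hj, hj1, -, -⟩ := hw k (by omega) hk.2
    rw [hj, mul_div_assoc']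
    gcongr
    nlinarith
  -- The linear lower bound `h / K` on the stepsizes suffices near the end; for earlier steps the
  -- quadratic growth of the tail sums, from `r / T ≤ j / K`, is needed.
  have hS2 : ∀ t, 1 ≤ t → t ≤ T + 1 → h / (2 * T) * ((T + 1 - t : ℕ) : ℝ) ^ 2 ≤
      ∑ k ∈ Finset.Icc t T, stepEpochDecay n T η k := by
    intro t ht htT
    induction htT using Nat.decreasingInduction with
    | self => simp
    | of_succ t htT ih =>
      have h1 := ih (by omega)
      obtain ⟨j, hj, hj1, hj2, -⟩ := hw t ht (by omega)
      have e : Finset.Icc t T = insert t (Finset.Icc (t + 1) T) := by ext; simp; omega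
      have e2 : ((T + 1 - t : ℕ) : ℝ) = ((T + 1 - (t + 1) : ℕ) : ℝ) + 1 := by
        exact_mod_cast (by omega : T + 1 - t = (T + 1 - (t + 1)) + 1)
      have h2 : ((T + 1 - t : ℕ) : ℝ) ≤ T := by exact_mod_cast (by omega : T + 1 - t ≤ T)
      have h0 : (0 : ℝ) ≤ ((T + 1 - t : ℕ) : ℝ) := Nat.cast_nonneg _
      rw [e, Finset.sum_insert (by simp), hj]
      set r : ℝ := ((T + 1 - t : ℕ) : ℝ)
      have h3 : r / T ≤ j / K := by
        rw [div_le_div_iff₀ hT' hK]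
        refine le_of_mul_le_mul_right ?_ hn
        nlinarith [mul_le_mul_of_nonneg_right hj2 hT'.le,
          mul_nonneg (sub_nonneg.2 hKn) (sub_nonneg.2 h2)]
      have h4 := mul_le_mul_of_nonneg_left h3 hhpos.le
      have h5 : h / (2 * T) * r ^ 2 - h / (2 * T) * ((T + 1 - (t + 1) : ℕ) : ℝ) ^ 2 ≤
          h * (r / T) := by
        have e3 : ((T + 1 - (t + 1) : ℕ) : ℝ) = r - 1 := by linarith
        rw [e3]
        have e4 : h * (r / T) = h / (2 * T) * (2 * r) := by field_simp
        rw [e4, ← mul_sub]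
        refine mul_le_mul_of_nonneg_left ?_ (by positivity)
        nlinarith
      linarith
  constructor
  · refine le_trans (le_of_eq ?_) (hS2 1 le_rfl (by omega))
    rw [Nat.add_sub_cancel, hh]
    field_simp
    linear_combination hss
  · have h1 : ∀ t ∈ Finset.Icc 1 T,
        stepEpochDecay n T η t ^ 2 / ∑ k ∈ Finset.Icc t T, stepEpochDecay n T η k ≤
        8 * h / (K * n) + 16 * h / K *
          (if T + 1 - t ≤ 2 * n then ((T + 1 - t : ℕ) : ℝ)⁻¹ else 0) := by
      intro t ht
      rw [Finset.mem_Icc] at ht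
      obtain ⟨j, hj, hj1, hj2, hj3⟩ := hw t ht.1 ht.2
      have hr : (0 : ℝ) < ((T + 1 - t : ℕ) : ℝ) := by exact_mod_cast (by omega : 0 < T + 1 - t)
      have h2 := hS1 t ht.1 ht.2
      have h3 := hS2 t ht.1 (by omega)
      rw [hj]
      split_ifs with hc
      · have hc' : ((T + 1 - t : ℕ) : ℝ) ≤ 2 * n := by exact_mod_cast hc
        set r : ℝ := ((T + 1 - t : ℕ) : ℝ)
        have hj4 : j ≤ 4 := le_of_mul_le_mul_right (by linarith) hn
        calc _ ≤ (h * (4 / K)) ^ 2 / (r * (h / K)) := by gcongr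
          _ = 16 * h / K * r⁻¹ := by field_simp; norm_num
          _ ≤ _ := le_add_of_nonneg_left (by positivity)
      · have hc' : (2 * n : ℝ) ≤ ((T + 1 - t : ℕ) : ℝ) := by exact_mod_cast (not_le.1 hc).le
        set r : ℝ := ((T + 1 - t : ℕ) : ℝ)
        have hj4 : j ≤ 2 * r / n := by rw [le_div_iff₀ hn]; linarith
        calc _ ≤ (h * (2 * r / n / K)) ^ 2 / (h / (2 * (K * n)) * r ^ 2) := by
              have : h / (2 * (K * n)) * r ^ 2 ≤ h / (2 * T) * r ^ 2 := by gcongr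
              gcongr
              exact this.trans h3
          _ = 8 * h / (K * n) := by field_simp; norm_num
          _ ≤ _ := by simp
    refine (Finset.sum_le_sum h1).trans ?_
    rw [Finset.sum_add_distrib, ← Finset.mul_sum, Finset.sum_const, Nat.card_Icc,
      Nat.add_sub_cancel, nsmul_eq_mul,
      sum_Icc_reflect T fun t => if t ≤ 2 * n then (t : ℝ)⁻¹ else 0]
    have h2 : ∑ t ∈ Finset.Icc 1 T, (if t ≤ 2 * n then (t : ℝ)⁻¹ else 0) ≤ 2 + Real.log n := by
      rw [← Finset.sum_filter]
      calc _ ≤ ∑ t ∈ Finset.Icc 1 (2 * n), (t : ℝ)⁻¹ := by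
            refine Finset.sum_le_sum_of_subset_of_nonneg (fun t ht => ?_)
              fun _ _ _ => by positivity
            rw [Finset.mem_filter, Finset.mem_Icc] at ht
            rw [Finset.mem_Icc]
            omega
        _ ≤ 1 + Real.log ((2 * n : ℕ) : ℝ) := sum_inv_le_one_add_log _
        _ ≤ _ := by
            push_cast
            rw [Real.log_mul (by norm_num) hn.ne']
            linarith [Real.log_two_lt_d9]
    have h3 : T * (8 * h / (K * n)) ≤ 8 * h := by
      rw [mul_div_assoc', div_le_iff₀ (by positivity)]
      nlinarith
    calc _ ≤ 8 * h + 16 * h / K * (2 + Real.log n) := by gcongr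
      _ = 8 * h + 32 * (h / K) + 16 * (h * (Real.log n / K)) := by ring
      _ ≤ 8 * h + 32 * h + 40 * (h * (Real.log n / K)) := by
          gcongr
          · exact div_le_self hhpos.le hK1
          · norm_num
      _ = _ := by rw [hh]; ring

end Stepsizes

/-! ### From random permutations to uniform averages -/

section Transfer

open scoped BigOperators

variable {Ω : Type*} [MeasurableSpace Ω] {P : Measure Ω} {d n K T : ℕ}
  {π : ℕ → Ω → Equiv.Perm (Fin n)}

theorem IsReshuffling.measurableSet_eq (h : IsReshuffling P n K π) (τ : PermSeq n K) :
    MeasurableSet {ω | (fun k : Finset.Icc 1 K => π k ω) = τ} := by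
  have e : {ω | (fun k : Finset.Icc 1 K => π k ω) = τ} =
      ⋂ k : Finset.Icc 1 K, (π k) ⁻¹' {τ k} := by
    ext ω; simp [funext_iff]
  rw [e]
  exact MeasurableSet.iInter fun k => h.measurable k k.2 trivial

theorem IsReshuffling.measure_eq (h : IsReshuffling P n K π) (τ : PermSeq n K) :
    P {ω | (fun k : Finset.Icc 1 K => π k ω) = τ} = ((n.factorial : ENNReal))⁻¹ ^ K := by
  have e : {ω | (fun k : Finset.Icc 1 K => π k ω) = τ} =
      ⋂ k ∈ (Finset.univ : Finset (Finset.Icc 1 K)), (π k) ⁻¹' {τ k} := by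
    ext ω; simp [funext_iff]
  rw [e, (iIndepFun_iff_measure_inter_preimage_eq_mul.1 h.independent) Finset.univ
    (sets := fun k => {τ k}) fun _ _ => trivial]
  have h1 : ∀ k : Finset.Icc 1 K, P ((π k) ⁻¹' {τ k}) = ((n.factorial : ENNReal))⁻¹ :=
    fun k => h.uniform k k.2 (τ k)
  simp [h1]

theorem IsReshuffling.exists_eq (h : IsReshuffling P n K π) (τ : PermSeq n K) :
    ∃ ω, (fun k : Finset.Icc 1 K => π k ω) = τ := by
  have h1 : P {ω | (fun k : Finset.Icc 1 K => π k ω) = τ} ≠ 0 := by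
    rw [h.measure_eq]
    exact pow_ne_zero _ (ENNReal.inv_ne_zero.2 (ENNReal.natCast_ne_top _))
  exact nonempty_of_measure_ne_zero h1

/-- The expectation of a function of the permutations is its average over all sequences. -/
theorem IsReshuffling.integral_comp [IsProbabilityMeasure P] (h : IsReshuffling P n K π)
    (φ : PermSeq n K → ℝ) :
    Integrable (fun ω => φ fun k => π k ω) P ∧ ∫ ω, φ (fun k => π k ω) ∂P = 𝔼 τ, φ τ := by
  let _ : MeasurableSpace (PermSeq n K) := ⊤
  have hmeas : Measurable fun (ω : Ω) (k : Finset.Icc 1 K) => π k ω :=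
    measurable_to_countable' fun τ => h.measurableSet_eq τ
  have : IsProbabilityMeasure (P.map fun (ω : Ω) (k : Finset.Icc 1 K) => π k ω) :=
    Measure.isProbabilityMeasure_map hmeas.aemeasurable
  have hint : Integrable φ (P.map fun (ω : Ω) (k : Finset.Icc 1 K) => π k ω) :=
    Integrable.of_finite
  refine ⟨hint.comp_measurable hmeas, ?_⟩
  rw [← integral_map hmeas.aemeasurable hint.aestronglyMeasurable, integral_fintype hint,
    Fintype.expect_eq_sum_div_card]
  have h1 : ∀ τ, (P.map fun (ω : Ω) (k : Finset.Icc 1 K) => π k ω).real {τ} =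
      ((n.factorial : ℝ))⁻¹ ^ K := by
    intro τ
    rw [map_measureReal_apply hmeas trivial, Measure.real]
    have := h.measure_eq τ
    rw [show (fun (ω : Ω) (k : Finset.Icc 1 K) => π k ω) ⁻¹' {τ} =
      {ω | (fun k : Finset.Icc 1 K => π k ω) = τ} from rfl, this]
    simp
  have h2 : Fintype.card (PermSeq n K) = n.factorial ^ K := by
    simp [PermSeq, Fintype.card_perm]
  simp only [h1, smul_eq_mul]
  rw [← Finset.mul_sum, h2]
  push_cast
  rw [inv_pow]
  ring

/-- Since the proximal step is unique, the iterates are functions of the permutations. -/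
theorem exists_run_permSeq [NeZero n] {p : Problem d n} {x₁ : Vec d} {η : ℕ → ℝ}
    {x : ℕ → Ω → Vec d} (h : IsReshuffling P n (epoch n T) π)
    (hη : ∀ t, 1 ≤ t → t ≤ T → 0 < η t) (hx : IsRRRun p x₁ T π η x) :
    ∃ y : ℕ → PermSeq n (epoch n T) → Vec d, IsRRRun p x₁ T coordPerm η y ∧
      ∀ ω, x (T + 1) ω = y (T + 1) fun k => π k ω := by
  have hI : ∀ ω t, 1 ≤ t → t ≤ T →
      rrIndex π ω t = rrIndex coordPerm (fun k : Finset.Icc 1 (epoch n T) => π k ω) t := by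
    intro ω t ht htT
    obtain ⟨m, hm, -⟩ := exists_epoch_start (n := n) ht
    have : epoch n t ∈ Finset.Icc 1 (epoch n T) :=
      Finset.mem_Icc.2 ⟨by omega, epoch_mono htT⟩
    rw [rrIndex, rrIndex, coordPerm, dif_pos this]
  choose ω hω using h.exists_eq
  have hy : IsRRRun p x₁ T coordPerm η fun t τ => x t (ω τ) := by
    intro τ
    refine ⟨(hx (ω τ)).1, fun t ht htT => ?_⟩
    have h1 := (hx (ω τ)).2 t ht htT
    rwa [hI _ t ht htT, hω] at h1
  refine ⟨_, hy, fun ω' => ?_⟩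
  exact (hx ω').eq_of_forall_lt (hy _) hη (by omega) le_rfl
    fun k hk hkT => hI ω' k hk (by omega)

end Transfer

/-! ### The rates -/

section Rates

variable {Ω : Type*} [MeasurableSpace Ω] {P : Measure Ω} {d n T : ℕ} {p : Problem d n}

theorem Problem.F_eq_coe (p : Problem d n) {x : Vec d} (hx : x ∈ dom p.ψ) :
    p.F x = ((p.loss x + p.reg x : ℝ) : EReal) := by
  rw [Problem.F, ← p.coe_reg hx, EReal.coe_add, Problem.loss]

theorem ExpectedGapLE.mono {X : Ω → Vec d} {v : EReal} {B B' : ℝ}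
    (h : ExpectedGapLE P p X v B) (hB : B ≤ B') : ExpectedGapLE P p X v B' :=
  ⟨h.1, h.2.1, h.2.2.trans (by gcongr)⟩

/-- The rate for a general scale `η`. -/
theorem expectedGapLE_of_stepsizeRate [NeZero n] [IsProbabilityMeasure P]
    {π : ℕ → Ω → Equiv.Perm (Fin n)} (hT : 1 ≤ T) {x₁ : Vec d} (hx₁ : x₁ ∈ dom p.ψ)
    (hπ : IsReshuffling P n (epoch n T) π) {w : ℕ → ℝ} {η l : ℝ} (hη : 0 < η)
    (hw : SlowlyVarying n T w) (hr : StepsizeRate T w η l) (z : Vec d) {x : ℕ → Ω → Vec d}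
    (hx : IsRRRun p x₁ T π w x) :
    ExpectedGapLE P p (x (T + 1)) (p.F z)
      (960 * ((‖z - x₁‖ ^ 2 / η + η * Real.sqrt n * p.G1 * p.G2 * l) / Real.sqrt T)) := by
  obtain ⟨y, hy, hxy⟩ := exists_run_permSeq hπ hw.pos hx
  have hdom : ∀ ω, x (T + 1) ω ∈ dom p.ψ := fun ω => (hx ω).mem_dom hx₁ (by omega) le_rfl
  have hF : (fun ω => (p.F (x (T + 1) ω)).toReal) = fun ω =>
      p.loss (y (T + 1) fun k => π k ω) + p.reg (y (T + 1) fun k => π k ω) := by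
    funext ω
    rw [p.F_eq_coe (hdom ω), EReal.toReal_coe, hxy]
  obtain ⟨hint, heq⟩ := hπ.integral_comp fun τ => p.loss (y (T + 1) τ) + p.reg (y (T + 1) τ)
  refine ⟨fun ω => ?_, ?_, ?_⟩
  · rw [p.F_eq_coe (hdom ω)]
    exact EReal.coe_lt_top _
  · rw [hF]
    exact hint
  rw [hF, heq]
  by_cases hz : z ∈ dom p.ψ
  · rw [p.F_eq_coe hz, ← EReal.coe_add, EReal.coe_le_coe_iff]
    have h1 := expect_last_iterate_le hT le_rfl hx₁ hw hy hz
    have hs : 0 < Real.sqrt T := Real.sqrt_pos.mpr (by exact_mod_cast hT)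
    have hV := p.noise_pos
    have h2 : ‖z - x₁‖ ^ 2 / 2 / (∑ k ∈ Finset.Icc 1 T, w k) ≤
        ‖z - x₁‖ ^ 2 / η / Real.sqrt T := by
      calc _ ≤ ‖z - x₁‖ ^ 2 / 2 / (η * Real.sqrt T / 2) := by
            gcongr; exact hr.le_sum
        _ = _ := by field_simp
    have h3 := mul_le_mul_of_nonneg_left hr.sum_le (by positivity : 0 ≤ 24 * p.noise)
    have h4 : 0 ≤ ‖z - x₁‖ ^ 2 / η / Real.sqrt T := by positivity
    have e : 960 * ((‖z - x₁‖ ^ 2 / η + η * Real.sqrt n * p.G1 * p.G2 * l) / Real.sqrt T) =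
        960 * (‖z - x₁‖ ^ 2 / η / Real.sqrt T) +
          24 * p.noise * (40 * (η * l / Real.sqrt T)) := by
      rw [Problem.noise]; ring
    linarith
  -- Outside `dom ψ` the reference value is `⊤` and the bound is void.
  · have h1 : p.ψ z = ⊤ := by simpa [dom] using hz
    rw [Problem.F, h1, EReal.coe_add_top, EReal.top_add_coe]
    exact le_top

theorem rpow_quarter_mul_sqrt (p : Problem d n) (l : ℝ) :
    (n : ℝ) ^ ((1 : ℝ) / 4) * Real.sqrt (p.G1 * p.G2 * l) = Real.sqrt (p.noise * l) := by
  have h1 : (n : ℝ) ^ ((1 : ℝ) / 4) = Real.sqrt (Real.sqrt n) := by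
    rw [Real.sqrt_eq_rpow, Real.sqrt_eq_rpow, ← Real.rpow_mul (Nat.cast_nonneg n)]
    norm_num
  rw [h1, ← Real.sqrt_mul (Real.sqrt_nonneg _), Problem.noise]
  congr 1
  ring

/-- The value of the bound at `η = D / √(V l)`, which balances its two terms when `l = l'`. -/
theorem tuned_bound_le [NeZero n] (p : Problem d n) {D l l' : ℝ} (hD : 0 < D) (hl : 0 < l)
    (hll : l ≤ l') :
    960 * ((D ^ 2 / (D / ((n : ℝ) ^ ((1 : ℝ) / 4) * Real.sqrt (p.G1 * p.G2 * l))) +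
      D / ((n : ℝ) ^ ((1 : ℝ) / 4) * Real.sqrt (p.G1 * p.G2 * l)) * Real.sqrt n * p.G1 * p.G2 *
        l') / Real.sqrt T) ≤
    1920 * ((n : ℝ) ^ ((1 : ℝ) / 4) * Real.sqrt (p.G1 * p.G2) * D * (l' / Real.sqrt l) /
      Real.sqrt T) := by
  have hV := p.noise_pos
  have e0 : (n : ℝ) ^ ((1 : ℝ) / 4) * Real.sqrt (p.G1 * p.G2) = Real.sqrt p.noise := by
    simpa using rpow_quarter_mul_sqrt p 1
  rw [rpow_quarter_mul_sqrt, e0, Real.sqrt_mul hV.le]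
  have hv := Real.sqrt_pos.mpr hV
  have hsl := Real.sqrt_pos.mpr hl
  have e1 : ∀ a : ℝ, a * Real.sqrt n * p.G1 * p.G2 * l' = a * (p.noise * l') := fun a => by
    rw [Problem.noise]; ring
  rw [e1]
  have hvv := Real.mul_self_sqrt hV.le
  have hll' := Real.mul_self_sqrt hl.le
  have e2 : D ^ 2 / (D / (Real.sqrt p.noise * Real.sqrt l)) =
      Real.sqrt p.noise * D * (l / Real.sqrt l) := by
    field_simp
    linear_combination hll'
  have e3 : D / (Real.sqrt p.noise * Real.sqrt l) * (p.noise * l') =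
      Real.sqrt p.noise * D * (l' / Real.sqrt l) := by
    field_simp
    linear_combination -l' * hvv
  rw [e2, e3]
  have h1 : Real.sqrt p.noise * D * (l / Real.sqrt l) ≤
      Real.sqrt p.noise * D * (l' / Real.sqrt l) := by gcongr
  calc _ ≤ 960 * ((Real.sqrt p.noise * D * (l' / Real.sqrt l) +
        Real.sqrt p.noise * D * (l' / Real.sqrt l)) / Real.sqrt T) := by gcongr
    _ = _ := by ring

theorem one_le_one_add_log_div [NeZero n] :
    1 ≤ 1 + Real.log n / (epoch n T : ℝ) :=
  le_add_of_nonneg_right (div_nonneg (Real.log_natCast_nonneg n) (Nat.cast_nonneg _))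

/-- After `c n log n` steps there have been at least `c log n` epochs. -/
theorem log_div_epoch_le [NeZero n] (hT : 1 ≤ T) {c : ℝ} (hc : 0 < c)
    (h : c * ((n : ℝ) * Real.log n) ≤ T) : Real.log n / (epoch n T : ℝ) ≤ 1 / c := by
  have hn : 0 < (n : ℝ) := Nat.cast_pos.mpr (Nat.pos_of_ne_zero (NeZero.ne n))
  obtain ⟨M, hM, hMT⟩ := exists_epoch_start (n := n) hT
  rw [Finset.mem_Ioc] at hMT
  have h1 : (T : ℝ) ≤ ((M + 1 : ℕ) : ℝ) * n := by
    have : (T : ℝ) ≤ M * n + n := by exact_mod_cast hMT.2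
    push_cast; linarith
  rw [hM, div_le_div_iff₀ (by positivity) hc]
  refine le_of_mul_le_mul_right ?_ hn
  linarith

theorem expectedGapLE_tuned_stepEpochDecay [NeZero n] [IsProbabilityMeasure P]
    {π : ℕ → Ω → Equiv.Perm (Fin n)} (hT : 1 ≤ T) {x₁ : Vec d} (hx₁ : x₁ ∈ dom p.ψ)
    (hπ : IsReshuffling P n (epoch n T) π) {z : Vec d} (hz : z ≠ x₁) {x : ℕ → Ω → Vec d}
    (hx : IsRRRun p x₁ T π
      (stepEpochDecay n T (‖z - x₁‖ / ((n : ℝ) ^ ((1 : ℝ) / 4) *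
        Real.sqrt (p.G1 * p.G2 * (1 + Real.log n / (epoch n T : ℝ)))))) x) :
    ExpectedGapLE P p (x (T + 1)) (p.F z)
      (1920 * ((n : ℝ) ^ ((1 : ℝ) / 4) * Real.sqrt (p.G1 * p.G2) * ‖z - x₁‖ *
        Real.sqrt (1 + Real.log n / (epoch n T : ℝ)) / Real.sqrt T)) := by
  have hD : 0 < ‖z - x₁‖ := norm_pos_iff.mpr (sub_ne_zero.mpr hz)
  have hl : 0 < 1 + Real.log n / (epoch n T : ℝ) :=
    one_pos.trans_le one_le_one_add_log_div
  have hη : 0 < ‖z - x₁‖ / ((n : ℝ) ^ ((1 : ℝ) / 4) *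
      Real.sqrt (p.G1 * p.G2 * (1 + Real.log n / (epoch n T : ℝ)))) := by
    rw [rpow_quarter_mul_sqrt]
    exact div_pos hD (Real.sqrt_pos.mpr (mul_pos p.noise_pos hl))
  have h := (expectedGapLE_of_stepsizeRate hT hx₁ hπ hη (slowlyVarying_stepEpochDecay hT hη)
    (stepsizeRate_stepEpochDecay hT hη) z hx).mono (tuned_bound_le p hD hl le_rfl)
  rwa [Real.div_sqrt] at h

end Rates

end ShuffledProx

end

open ShuffledProx

theorem theorem1 :
    -- rates for every `η > 0` and every reference point `z`, with an absolute constant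
    (∃ C : ℝ, 0 < C ∧
      ∀ (d n T : ℕ) [NeZero n], 1 ≤ T →
      ∀ (p : ShuffledProx.Problem d n) (x₁ : ShuffledProx.Vec d), x₁ ∈ ShuffledProx.dom p.ψ →
      ∀ (Ω : Type*) [MeasurableSpace Ω] (P : Measure Ω) [IsProbabilityMeasure P]
        (π : ℕ → Ω → Equiv.Perm (Fin n)),
        ShuffledProx.IsReshuffling P n (ShuffledProx.epoch n T) π →
      ∀ (η : ℝ), 0 < η → ∀ (z : ShuffledProx.Vec d) (x : ℕ → Ω → ShuffledProx.Vec d),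
        (ShuffledProx.IsRRRun p x₁ T π (ShuffledProx.stepEpochDecay n T η) x →
          ShuffledProx.ExpectedGapLE P p (x (T + 1)) (p.F z)
            (C * ((‖z - x₁‖ ^ 2 / η + η * Real.sqrt n * p.G1 * p.G2 *
              (1 + Real.log n / (ShuffledProx.epoch n T : ℝ))) / Real.sqrt T))) ∧
        (ShuffledProx.IsRRRun p x₁ T π (ShuffledProx.stepConst T η) x →
          ShuffledProx.ExpectedGapLE P p (x (T + 1)) (p.F z)
            (C * ((‖z - x₁‖ ^ 2 / η + η * Real.sqrt n * p.G1 * p.G2 *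
              (1 + Real.log T)) / Real.sqrt T))) ∧
        (ShuffledProx.IsRRRun p x₁ T π (ShuffledProx.stepSqrt η) x →
          ShuffledProx.ExpectedGapLE P p (x (T + 1)) (p.F z)
            (C * ((‖z - x₁‖ ^ 2 / η + η * Real.sqrt n * p.G1 * p.G2 *
              (1 + Real.log T)) / Real.sqrt T)))) ∧
    -- rates for the tuned values of `η`, relative to any `z ≠ x₁`, with an absolute constant
    (∃ C : ℝ, 0 < C ∧
      ∀ (d n T : ℕ) [NeZero n], 1 ≤ T →
      ∀ (p : ShuffledProx.Problem d n) (x₁ : ShuffledProx.Vec d), x₁ ∈ ShuffledProx.dom p.ψ →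
      ∀ (Ω : Type*) [MeasurableSpace Ω] (P : Measure Ω) [IsProbabilityMeasure P]
        (π : ℕ → Ω → Equiv.Perm (Fin n)),
        ShuffledProx.IsReshuffling P n (ShuffledProx.epoch n T) π →
      ∀ (z : ShuffledProx.Vec d), z ≠ x₁ →
      ∀ (x : ℕ → Ω → ShuffledProx.Vec d),
        (ShuffledProx.IsRRRun p x₁ T π
            (ShuffledProx.stepEpochDecay n T
              (‖z - x₁‖ / ((n : ℝ) ^ ((1 : ℝ) / 4) *
                Real.sqrt (p.G1 * p.G2 *
                  (1 + Real.log n / (ShuffledProx.epoch n T : ℝ)))))) x →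
          ShuffledProx.ExpectedGapLE P p (x (T + 1)) (p.F z)
            (C * ((n : ℝ) ^ ((1 : ℝ) / 4) * Real.sqrt (p.G1 * p.G2) * ‖z - x₁‖ *
              Real.sqrt (1 + Real.log n / (ShuffledProx.epoch n T : ℝ)) / Real.sqrt T))) ∧
        (ShuffledProx.IsRRRun p x₁ T π
            (ShuffledProx.stepConst T
              (‖z - x₁‖ / ((n : ℝ) ^ ((1 : ℝ) / 4) *
                Real.sqrt (p.G1 * p.G2 * (1 + Real.log T))))) x →
          ShuffledProx.ExpectedGapLE P p (x (T + 1)) (p.F z)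
            (C * ((n : ℝ) ^ ((1 : ℝ) / 4) * Real.sqrt (p.G1 * p.G2) * ‖z - x₁‖ *
              Real.sqrt (1 + Real.log T) / Real.sqrt T))) ∧
        (ShuffledProx.IsRRRun p x₁ T π
            (ShuffledProx.stepSqrt
              (‖z - x₁‖ / ((n : ℝ) ^ ((1 : ℝ) / 4) * Real.sqrt (p.G1 * p.G2)))) x →
          ShuffledProx.ExpectedGapLE P p (x (T + 1)) (p.F z)
            (C * ((n : ℝ) ^ ((1 : ℝ) / 4) * Real.sqrt (p.G1 * p.G2) * ‖z - x₁‖ *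
              (1 + Real.log T) / Real.sqrt T)))) ∧
    -- no logarithm for the tuned epoch-decaying stepsize when `T ≥ c n log n`
    (∀ c : ℝ, 0 < c → ∃ C : ℝ, 0 < C ∧
      ∀ (d n T : ℕ) [NeZero n], 1 ≤ T → c * ((n : ℝ) * Real.log n) ≤ T →
      ∀ (p : ShuffledProx.Problem d n) (x₁ : ShuffledProx.Vec d), x₁ ∈ ShuffledProx.dom p.ψ →
      ∀ (Ω : Type*) [MeasurableSpace Ω] (P : Measure Ω) [IsProbabilityMeasure P]
        (π : ℕ → Ω → Equiv.Perm (Fin n)),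
        ShuffledProx.IsReshuffling P n (ShuffledProx.epoch n T) π →
      ∀ (z : ShuffledProx.Vec d), z ≠ x₁ →
      ∀ (x : ℕ → Ω → ShuffledProx.Vec d),
        ShuffledProx.IsRRRun p x₁ T π
            (ShuffledProx.stepEpochDecay n T
              (‖z - x₁‖ / ((n : ℝ) ^ ((1 : ℝ) / 4) *
                Real.sqrt (p.G1 * p.G2 *
                  (1 + Real.log n / (ShuffledProx.epoch n T : ℝ)))))) x →
          ShuffledProx.ExpectedGapLE P p (x (T + 1)) (p.F z)
            (C * ((n : ℝ) ^ ((1 : ℝ) / 4) * Real.sqrt (p.G1 * p.G2) * ‖z - x₁‖ /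
              Real.sqrt T))) := by
  have hlog : ∀ T : ℕ, 0 < 1 + Real.log T := fun T => by
    linarith [Real.log_natCast_nonneg T]
  refine ⟨⟨960, by norm_num, ?_⟩, ⟨1920, by norm_num, ?_⟩, fun c hc =>
    ⟨1920 * Real.sqrt (1 + 1 / c), by positivity, ?_⟩⟩
  · intro d n T _ hT p x₁ hx₁ Ω _ P _ π hπ η hη z x
    refine ⟨fun hx => ?_, fun hx => ?_, fun hx => ?_⟩
    · exact expectedGapLE_of_stepsizeRate hT hx₁ hπ hη
        (slowlyVarying_stepEpochDecay hT hη)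
        (stepsizeRate_stepEpochDecay hT hη) z hx
    · exact expectedGapLE_of_stepsizeRate hT hx₁ hπ hη (slowlyVarying_stepConst hT hη)
        (stepsizeRate_stepConst hT hη) z hx
    · exact expectedGapLE_of_stepsizeRate hT hx₁ hπ hη (slowlyVarying_stepSqrt hη)
        (stepsizeRate_stepSqrt hT hη) z hx
  · intro d n T _ hT p x₁ hx₁ Ω _ P _ π hπ z hz x
    have hD : 0 < ‖z - x₁‖ := norm_pos_iff.mpr (sub_ne_zero.mpr hz)
    refine ⟨fun hx => expectedGapLE_tuned_stepEpochDecay hT hx₁ hπ hz hx, fun hx => ?_,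
      fun hx => ?_⟩
    · have hη : 0 < ‖z - x₁‖ / ((n : ℝ) ^ ((1 : ℝ) / 4) *
          Real.sqrt (p.G1 * p.G2 * (1 + Real.log T))) := by
        rw [rpow_quarter_mul_sqrt]
        exact div_pos hD (Real.sqrt_pos.mpr (mul_pos p.noise_pos (hlog T)))
      have h := (expectedGapLE_of_stepsizeRate hT hx₁ hπ hη
        (slowlyVarying_stepConst hT hη) (stepsizeRate_stepConst hT hη) z hx).mono
        (tuned_bound_le p hD (hlog T) le_rfl)
      rwa [Real.div_sqrt] at h
    -- The third stepsize is tuned without the logarithm, that is, with `l = 1`.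
    · rw [← mul_one (p.G1 * p.G2)] at hx
      have hη : 0 < ‖z - x₁‖ / ((n : ℝ) ^ ((1 : ℝ) / 4) * Real.sqrt (p.G1 * p.G2 * 1)) := by
        rw [rpow_quarter_mul_sqrt]
        exact div_pos hD (Real.sqrt_pos.mpr (mul_pos p.noise_pos one_pos))
      have h := (expectedGapLE_of_stepsizeRate hT hx₁ hπ hη
        (slowlyVarying_stepSqrt hη) (stepsizeRate_stepSqrt hT hη) z hx).mono
        (tuned_bound_le p hD one_pos (by linarith [Real.log_natCast_nonneg T]))
      rwa [Real.sqrt_one, div_one] at h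
  · intro d n T _ hT hcT p x₁ hx₁ Ω _ P _ π hπ z hz x hx
    refine (expectedGapLE_tuned_stepEpochDecay hT hx₁ hπ hz hx).mono ?_
    have h1 : Real.sqrt (1 + Real.log n / (epoch n T : ℝ)) ≤ Real.sqrt (1 + 1 / c) :=
      Real.sqrt_le_sqrt (by linarith [log_div_epoch_le hT hc hcT])
    calc _ ≤ 1920 * ((n : ℝ) ^ ((1 : ℝ) / 4) * Real.sqrt (p.G1 * p.G2) * ‖z - x₁‖ *
          Real.sqrt (1 + 1 / c) / Real.sqrt T) := by gcongr
      _ = _ := by ring
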